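/- There are absolute constants $C_0, C_1, C_2 > 0$ such that the following holds. Let $n \ge 2$, $\epsilon \in (0, 1/2]$, $p \in [0,1]$ with $p \ge C_1 \log(n)/n$, and let $k$ be an integer with $k \ge C_2 \log(n)/\epsilon^2$. Let $\mathcal{G}_{\mathrm{ER}} \sim G(n,p)$ be an Erdős–Rényi graph on $\mathcal{V}=[n]$, and let $\mathcal{G}_{\mathrm{SR}} = (\mathcal{V}, \mathcal{E}_{\mathrm{SR}})$ be obtained from it by an adversary who observes $\mathcal{G}_{\mathrm{ER}}$ and adds edges arbitrarily. For $i \neq j$ put $L_{ij} = (e_i - e_j)(e_i-e_j)^\top$; for edge weights $w$ put $L_w = \sum_{ij \in \mathcal{E}_{\mathrm{SR}}} w_{ij} L_{ij}$. Write $\langle A, B\rangle = \mathrm{tr}(A^\top B)$, and let $\Pi$ be the orthogonal projector onto the orthogonal complement of the all-ones vector. Define $$\mathcal{F} = \Big\{ w \in \mathbb{R}_{\ge 0}^{\mathcal{E}_{\mathrm{SR}}} : \sum_{j : ij \in \mathcal{E}_{\mathrm{SR}}} w_{ij} \le 2np \ \ \forall i \in \mathcal{V}, \quad w_{ij} \le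 1 \ \ \forall ij \in \mathcal{E}_{\mathrm{SR}} \Big\},$$ $$\Delta = \{ X \in \mathbb{R}^{n \times n} \text{ symmetric} : X \succeq 0, \ \langle \Pi, X \rangle = 1\}, \qquad \mathrm{OPT} = \max_{w \in \mathcal{F}} \min_{X \in \Delta} \langle L_w, X\rangle .$$ Consider the following algorithm. Put $w^{(0)} = 0$, $\eta = \epsilon/(4pn)$, $T = \lceil 8\log(n)/\epsilon^2 \rceil$. For $t = 0, \dots, T-1$: sample $R \in \{\pm 1/\sqrt{k}\}^{n \times k}$ uniformly at random, independently of everything before; compute $U = \exp(-\eta L_{w^{(t)}}) R$ and $V = U / \sqrt{\langle \Pi, U U^\top \rangle}$; compute the gains $c_{ij} = \langle L_{ij}, V V^\top\rangle$ for $ij \in \mathcal{E}_{\mathrm{SR}}$; obtain from an oracle an approximate solution $\hat w^{(t)} \in \mathcal{F}$ of $\max_{w \in \mathcal{F}} \langle c, w\rangle$; and set $w^{(t+1)} = w^{(t)} + \hat w^{(t)}$. Output $w_{\mathrm{out}} = \frac{1}{T} \sum_{t=0}^{T-1} \hat w^{(t)}$. The oracle may be randomized and may depend on the past, and it is one of the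 following: * the LP oracle: any procedure returning $\hat w \in \mathcal{F}$ with $\langle c, \hat w \rangle \ge (1-\epsilon) \max_{w \in \mathcal{F}} \langle c, w\rangle$; * the greedy oracle: the procedure that runs once through the edges in decreasing order of gain and gives each edge the largest weight, at most $1$, that keeps the weighted degrees of both its endpoints at most $2np$; or, more generally, any procedure returning $\hat w \in \mathcal{F}$ with $\langle c, \hat w \rangle \ge \frac12 \max_{w \in \mathcal{F}} \langle c, w\rangle$. Then, with probability at least $1 - n^{-10}$ over the random graph and the algorithm's randomness, $w_{\mathrm{out}} \in \mathcal{F}$ and $$\min_{X \in \Delta} \langle L_{w_{\mathrm{out}}}, X \rangle \ \ge\ \begin{cases} (1 - C_0\epsilon)\cdot \mathrm{OPT}, & \text{if the LP oracle is used},\\ (\tfrac12 - C_0 \epsilon) \cdot \mathrm{OPT}, & \text{if the greedy oracle is used}.\end{cases}$$ -/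

import Mathlib

open MeasureTheory ProbabilityTheory
open scoped SimpleGraph

namespace MMWU

noncomputable section

/-- Edge weights on the vertex set `Fin n`, indexed by unordered pairs. A weighting of a graph `G` is
one that vanishes outside the edge set of `G`. -/
abbrev Weights (n : ℕ) : Type := Sym2 (Fin n) → ℝ

/-- Entrywise (trace) inner product of real matrices. -/
def matInner {n : ℕ} (A B : Matrix (Fin n) (Fin n) ℝ) : ℝ :=
  ∑ i, ∑ j, A i j * B i j

/-- The Laplacian `(e_i - e_j)(e_i - e_j)ᵀ` of the single edge `{i, j}`. -/
def edgeLap {n : ℕ} (e : Sym2 (Fin n)) : Matrix (Fin n) (Fin n) ℝ :=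
  Sym2.lift ⟨fun i j =>
    Matrix.vecMulVec (Pi.single i (1 : ℝ) - Pi.single j 1) (Pi.single i (1 : ℝ) - Pi.single j 1),
    fun i j => by
      ext a b
      simp only [Matrix.vecMulVec_apply, Pi.sub_apply]
      ring⟩ e

/-- The weighted Laplacian `L_w = ∑ w_ij (e_i - e_j)(e_i - e_j)ᵀ`. -/
def lap {n : ℕ} (w : Weights n) : Matrix (Fin n) (Fin n) ℝ :=
  ∑ e, w e • edgeLap e

/-- The orthogonal projector onto the complement of the all-ones vector. -/
def projPerpOnes (n : ℕ) : Matrix (Fin n) (Fin n) ℝ :=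
  1 - Matrix.of fun _ _ => (1 / n : ℝ)

/-- The set `Δ` of positive semidefinite `X` with `⟨Π, X⟩ = 1`, where `Π` projects onto `1^⊥`. -/
def specSet (n : ℕ) : Set (Matrix (Fin n) (Fin n) ℝ) :=
  {X | X.PosSemidef ∧ matInner (projPerpOnes n) X = 1}

/-- The weighted degree of a vertex. -/
def wdeg {n : ℕ} (w : Weights n) (i : Fin n) : ℝ := ∑ j, w s(i, j)

/-- The feasible set `F`: nonnegative weights on the edges of `G`, at most `1` on each edge, with all
weighted degrees at most `2np`. -/
def feasible {n : ℕ} (G : SimpleGraph (Fin n)) (p : ℝ) : Set (Weights n) :=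
  {w | (∀ e, 0 ≤ w e) ∧ (∀ e, e ∉ G.edgeSet → w e = 0) ∧
    (∀ i, wdeg w i ≤ 2 * n * p) ∧ (∀ e ∈ G.edgeSet, w e ≤ 1)}

/-- The spectral objective `min_{X ∈ Δ} ⟨L_w, X⟩`. For `n ≥ 2` and `w ≥ 0` the set of values is
nonempty and bounded below by `0`. -/
def objective {n : ℕ} (w : Weights n) : ℝ :=
  sInf ((fun X => matInner (lap w) X) '' specSet n)

/-- `OPT = max_{w ∈ F} min_{X ∈ Δ} ⟨L_w, X⟩`. -/
def opt {n : ℕ} (G : SimpleGraph (Fin n)) (p : ℝ) : ℝ :=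
  sSup (objective '' feasible G p)

/-! ### The two oracles for `max_{w ∈ F} ⟨c, w⟩` -/

/-- `w` is feasible and has at least an `α` fraction of the maximum of `⟨c, w'⟩` over `w' ∈ F`. -/
def IsApproxSolution {n : ℕ} (α p : ℝ) (G : SimpleGraph (Fin n)) (c w : Weights n) : Prop :=
  w ∈ feasible G p ∧ ∀ w' ∈ feasible G p, α * ∑ e, c e * w' e ≤ ∑ e, c e * w e

/-- The smaller of the two remaining demands at the endpoints of `e`, when every vertex has total
demand `b`. -/
def residual {n : ℕ} (b : ℝ) (w : Weights n) (e : Sym2 (Fin n)) : ℝ :=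
  Sym2.lift ⟨fun i j => min (b - wdeg w i) (b - wdeg w j), fun _ _ => min_comm _ _⟩ e

/-- One greedy step: put as much weight on `e` (at most `1`) as the remaining demands of its two
endpoints allow. -/
def greedyStep {n : ℕ} (b : ℝ) (w : Weights n) (e : Sym2 (Fin n)) : Weights n :=
  Function.update w e (min 1 (residual b w e))

/-- `w` results from running through the edges of `G` once, in some order of decreasing gain `c`,
and performing a greedy step at each of them, with vertex demands `2np`. -/
def IsGreedySolution {n : ℕ} (p : ℝ) (G : SimpleGraph (Fin n)) (c w : Weights n) : Prop :=
  ∃ l : List (Sym2 (Fin n)), l.Nodup ∧ (∀ e, e ∈ l ↔ e ∈ G.edgeSet) ∧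
    l.Pairwise (fun e e' => c e' ≤ c e) ∧ w = l.foldl (greedyStep (2 * n * p)) 0

/-! ### The algorithm -/

/-- The step size `η = ε / (4pn)`. -/
def stepSize (n : ℕ) (p ε : ℝ) : ℝ := ε / (4 * p * n)

/-- The number of iterations `T = 8 log n / ε²`, rounded up. -/
def numIter (n : ℕ) (ε : ℝ) : ℕ := ⌈8 * Real.log n / ε ^ 2⌉₊

/-- The finite set `{±1/√k}^{n × k}`. -/
def signMatrices (n k : ℕ) : Set (Fin n → Fin k → ℝ) :=
  {R | ∀ i j, R i j = 1 / √(k : ℝ) ∨ R i j = -(1 / √(k : ℝ))}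

/-- `U = exp(-η L_w) R`. -/
def sketch {n k : ℕ} (p ε : ℝ) (w : Weights n) (R : Fin n → Fin k → ℝ) :
    Matrix (Fin n) (Fin k) ℝ :=
  NormedSpace.exp (-(stepSize n p ε) • lap w) * Matrix.of R

/-- `V = U / √⟨Π, U Uᵀ⟩`. -/
def normSketch {n k : ℕ} (p ε : ℝ) (w : Weights n) (R : Fin n → Fin k → ℝ) :
    Matrix (Fin n) (Fin k) ℝ :=
  (√(matInner (projPerpOnes n) (sketch p ε w R * (sketch p ε w R).transpose)))⁻¹ • sketch p ε w R

/-- The edge gains `c_ij = ⟨L_ij, V Vᵀ⟩`. -/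
def gains {n k : ℕ} (p ε : ℝ) (w : Weights n) (R : Fin n → Fin k → ℝ) : Weights n :=
  fun e => matInner (edgeLap e) (normSketch p ε w R * (normSketch p ε w R).transpose)

/-- The accumulated weights `w^(t)`: `w^(0) = 0` and `w^(t+1) = w^(t) + ŵ^(t)`. -/
def accum {n : ℕ} (what : ℕ → Weights n) : ℕ → Weights n
  | 0 => 0
  | t + 1 => accum what t + what t

/-- The output `(1/T) ∑_{t<T} ŵ^(t)`, the average of the oracle answers. -/
def output {n : ℕ} (ε : ℝ) (what : ℕ → Weights n) : Weights n :=
  (1 / (numIter n ε : ℝ)) • ∑ t ∈ Finset.range (numIter n ε), what t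

/-- An execution of the algorithm, as a stochastic process, on the (random) graph `G`, with sketch
dimension `k`. `R t` is the sketching matrix and `what t` the oracle's answer of iteration `t`; the
σ-algebra `ℱ t` describes everything that has happened before iteration `t`, including the choice
of `G` and any internal randomness of the oracle. `solves H c w` says that `w` is an acceptable
answer of the oracle on the graph `H` with gains `c`. -/
structure IsRun {n k : ℕ} {Ω : Type*} [mΩ : MeasurableSpace Ω] (P : Measure Ω)
    (G : Ω → SimpleGraph (Fin n)) (p ε : ℝ)
    (solves : SimpleGraph (Fin n) → Weights n → Weights n → Prop)
    (ℱ : Filtration ℕ mΩ) (R : ℕ → Ω → Fin n → Fin k → ℝ) (what : ℕ → Ω → Weights n) : Prop where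
  graph_measurable : Measurable[ℱ 0] G
  sample_measurable : ∀ t < numIter n ε, Measurable[ℱ (t + 1)] (R t)
  answer_measurable : ∀ t < numIter n ε, Measurable[ℱ (t + 1)] (what t)
  /-- The sketching matrices are uniform ... -/
  sample_law : ∀ t < numIter n ε, HasLaw (R t) (uniformOn (signMatrices n k)) P
  /-- ... and sampled afresh in each iteration. -/
  sample_indep : ∀ t < numIter n ε,
    Indep (MeasurableSpace.comap (R t) inferInstance) (ℱ t) P
  /-- The oracle's answer in iteration `t` is acceptable for the gains of that iteration. -/
  answer_solves : ∀ t < numIter n ε, ∀ ω,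
    solves (G ω) (gains p ε (accum (fun s => what s ω) t) (R t ω)) (what t ω)

end

end MMWU

/-!
Matrix multiplicative weights with the potential `Φ(w) = ⟨Π, exp(-s L_w)⟩`, where `s = 2η`. The role
of the Golden–Thompson inequality is played by a second-order bound on `tr exp(A - D)` for `D ⪰ 0`,
which follows from the fact that `D` intertwines the eigenbases of `A` and `A - D`. As `s L_ŵ ⪯ 4ε`,
it shows that a round with answer `ŵ` multiplies `Φ` by at most
`exp(-(1 - O(ε)) s ⟨L_ŵ, exp(-s L_w)⟩ / Φ(w))`. The oracle makes the last quotient at least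
`(1 - O(ε)) α OPT` if the sketched gains are accurate, whereas `Φ(w) ≥ exp(-s ⟨L_w, X⟩)` for all
`X ∈ Δ`. Greedy answers are `1/2`-approximate by linear programming duality: a saturated vertex is
priced at the least gain of a used edge at it, and the other vertices are free.

The number of rounds grows as `ε → 0` with `n` fixed, so there is no union bound over the sketches.
Instead, given the past, the expected amount by which the relative errors of a sketch exceed `ε` is
at most `ε n⁻¹¹`, and Markov's inequality bounds the sum of these excesses over all rounds.

The additive error `log n / (s T)` of the method is at most `ε OPT` because `OPT ≥ np / 4`: the
adversary only adds edges, and the Erdős–Rényi graph itself is a feasible weighting with that value.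
Its spectral gap and its degrees are controlled by the expectations of `Φ` and of `2 ^ degree` as
functions of the edge probability, for which Russo's formula gives a differential inequality.
-/

namespace MMWU

section MatrixExponential

open Matrix
open scoped MatrixOrder

variable {m : Type*} [Fintype m] [DecidableEq m]

lemma exists_orthogonal_diagonalization {A : Matrix m m ℝ} (hA : A.IsHermitian) :
    ∃ (U : Matrix m m ℝ) (a : m → ℝ), Uᵀ * U = 1 ∧ U * Uᵀ = 1 ∧ A = U * diagonal a * Uᵀ ∧
      NormedSpace.exp A = U * diagonal (fun i => Real.exp (a i)) * Uᵀ := by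
  set U : Matrix m m ℝ := ↑hA.eigenvectorUnitary
  have hUU : Uᵀ * U = 1 := Unitary.coe_star_mul_self hA.eigenvectorUnitary
  have hUU' : U * Uᵀ = 1 := mul_eq_one_comm.1 hUU
  have hdiag : A = U * diagonal hA.eigenvalues * Uᵀ := hA.spectral_theorem
  refine ⟨U, hA.eigenvalues, hUU, hUU', hdiag, ?_⟩
  conv_lhs => rw [hdiag, ← inv_eq_left_inv hUU, exp_conj _ _ (.of_mul_eq_one _ hUU'), exp_diagonal]
  rw [inv_eq_left_inv hUU, Pi.exp_def, Real.exp_eq_exp_ℝ]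

lemma posSemidef_exp {A : Matrix m m ℝ} (hA : A.IsHermitian) :
    (NormedSpace.exp A).PosSemidef := by
  obtain ⟨U, a, -, -, -, hexp⟩ := exists_orthogonal_diagonalization hA
  rw [hexp]
  exact (PosSemidef.diagonal fun i => (Real.exp_pos (a i)).le).mul_mul_conjTranspose_same U

omit [DecidableEq m] in
lemma trace_mul_nonneg {A X : Matrix m m ℝ} (hA : A.PosSemidef) (hX : X.PosSemidef) :
    0 ≤ trace (A * X) := by
  classical
  obtain ⟨Y, rfl⟩ := CStarAlgebra.nonneg_iff_eq_mul_star_self.1 hX.nonneg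
  rw [← Matrix.mul_assoc, trace_mul_comm, ← Matrix.mul_assoc]
  exact (hA.conjTranspose_mul_mul_same Y).trace_nonneg

lemma posSemidef_smul_sub_mul_self {D : Matrix m m ℝ} {ρ : ℝ} (hρ : 0 < ρ) (hD : D.PosSemidef)
    (hDρ : (ρ • 1 - D).PosSemidef) : (ρ • D - D * D).PosSemidef := by
  have hsum : D * (ρ • 1 - D) * D + (ρ • 1 - D) * D * (ρ • 1 - D) = ρ • (ρ • D - D * D) := by
    simp only [Matrix.mul_sub, Matrix.sub_mul, Matrix.mul_smul, Matrix.smul_mul, Matrix.mul_one,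
      Matrix.one_mul, smul_sub, Matrix.mul_assoc]
    abel
  have h := (hDρ.conjTranspose_mul_mul_same D).add (hD.conjTranspose_mul_mul_same (ρ • 1 - D))
  rw [hDρ.1.eq, hD.1.eq, hsum] at h
  simpa only [smul_smul, inv_mul_cancel₀ hρ.ne', one_smul] using h.smul (inv_nonneg.2 hρ.le)

lemma trace_mul_self_mul_le {D M : Matrix m m ℝ} {ρ : ℝ} (hρ : 0 < ρ) (hD : D.PosSemidef)
    (hDρ : (ρ • 1 - D).PosSemidef) (hM : M.PosSemidef) :
    trace (D ^ 2 * M) ≤ ρ * trace (D * M) := by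
  have h := trace_mul_nonneg (posSemidef_smul_sub_mul_self hρ hD hDρ) hM
  rw [Matrix.sub_mul, trace_sub, Matrix.smul_mul, trace_smul, smul_eq_mul] at h
  rw [sq]
  linarith

lemma trace_mul_conj_diagonal {U V : Matrix m m ℝ} (hV : V * Vᵀ = 1) (f : m → ℝ)
    (P Q : Matrix m m ℝ) :
    trace (P * Qᵀ * (U * diagonal f * Uᵀ)) =
      ∑ i, ∑ j, f i * ((Uᵀ * P * V) i j * (Uᵀ * Q * V) i j) := by
  have h : trace (P * Qᵀ * (U * diagonal f * Uᵀ)) =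
      trace (diagonal f * ((Uᵀ * P * V) * (Uᵀ * Q * V)ᵀ)) := by
    rw [← Matrix.mul_assoc, trace_mul_comm, trace_mul_comm (diagonal f)]
    simp only [transpose_mul, transpose_transpose, Matrix.mul_assoc]
    rw [← Matrix.mul_assoc V, hV, Matrix.one_mul]
  rw [h]
  simp only [trace, diag_apply, diagonal_mul, mul_apply (M := Uᵀ * P * V), transpose_apply,
    Finset.mul_sum]

/-- Since `A - B` intertwines the eigenbases of `A` and `B`, its powers up to the second are traced
against functions of `A` or of `B` as if `A` and `B` commuted. This fails for the third power. -/
lemma exists_trace_sub_pow_mul_exp_eq {A B : Matrix m m ℝ} (hA : A.IsHermitian)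
    (hB : B.IsHermitian) :
    ∃ (a b : m → ℝ) (q : m → m → ℝ), (∀ i j, 0 ≤ q i j) ∧ ∀ k ≤ 2,
      trace ((A - B) ^ k * NormedSpace.exp A) =
        ∑ i, ∑ j, q i j * ((a i - b j) ^ k * Real.exp (a i)) ∧
      trace ((A - B) ^ k * NormedSpace.exp B) =
        ∑ i, ∑ j, q i j * ((a i - b j) ^ k * Real.exp (b j)) := by
  obtain ⟨U, a, hU, hU', hAdiag, hAexp⟩ := exists_orthogonal_diagonalization hA
  obtain ⟨V, b, hV, hV', hBdiag, hBexp⟩ := exists_orthogonal_diagonalization hB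
  have hsymm : (A - B)ᵀ = A - B := isHermitian_iff_isSymm.1 (hA.sub hB)
  have hUA : Uᵀ * A = diagonal a * Uᵀ := by
    rw [hAdiag, Matrix.mul_assoc U, ← Matrix.mul_assoc, hU, Matrix.one_mul]
  have hBV : B * V = V * diagonal b := by
    rw [hBdiag, Matrix.mul_assoc _ Vᵀ, hV, Matrix.mul_one]
  have intertwine (k : ℕ) (hk : k ≤ 1) (i j : m) :
      (Uᵀ * (A - B) ^ k * V) i j = (a i - b j) ^ k * (Uᵀ * V) i j := by
    interval_cases k
    · simp
    · rw [pow_one, pow_one, Matrix.mul_sub, Matrix.sub_mul, hUA, Matrix.mul_assoc _ B, hBV,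
        ← Matrix.mul_assoc _ V, Matrix.mul_assoc, Matrix.sub_apply, diagonal_mul, mul_diagonal]
      ring
  have intertwine' (k : ℕ) (hk : k ≤ 1) (i j : m) :
      (Vᵀ * (A - B) ^ k * U) j i = (a i - b j) ^ k * (Uᵀ * V) i j := by
    rw [← intertwine k hk, ← transpose_apply (Uᵀ * _ * V), transpose_mul, transpose_mul,
      transpose_transpose, transpose_pow, hsymm, Matrix.mul_assoc]
  refine ⟨a, b, fun i j => (Uᵀ * V) i j ^ 2, fun i j => sq_nonneg _, fun k hk => ?_⟩
  obtain ⟨l, l', hl, hl', rfl⟩ : ∃ l l', l ≤ 1 ∧ l' ≤ 1 ∧ k = l + l' :=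
    ⟨k - 1, min k 1, by omega, by omega, by omega⟩
  have hsplit : (A - B) ^ (l + l') = (A - B) ^ l * ((A - B) ^ l')ᵀ := by
    rw [transpose_pow, hsymm, pow_add]
  rw [hsplit, hAexp, hBexp, trace_mul_conj_diagonal hV', trace_mul_conj_diagonal hU']
  simp only [intertwine _ hl, intertwine _ hl', intertwine' _ hl, intertwine' _ hl']
  constructor
  · exact Finset.sum_congr rfl fun i _ => Finset.sum_congr rfl fun j _ => by ring
  · rw [Finset.sum_comm]
    exact Finset.sum_congr rfl fun i _ => Finset.sum_congr rfl fun j _ => by ring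

lemma exp_sub_exp_le (a b : ℝ) : Real.exp b - Real.exp a ≤ -((a - b) * Real.exp b) := by
  have h := mul_le_mul_of_nonneg_right (Real.add_one_le_exp (a - b)) (Real.exp_pos b).le
  rw [← Real.exp_add, sub_add_cancel] at h
  linarith

lemma sub_mul_exp_sub_exp_le (a b : ℝ) :
    (a - b) * (Real.exp a - Real.exp b) ≤ (a - b) ^ 2 * (Real.exp a + Real.exp b) := by
  wlog hab : b ≤ a generalizing a b
  · linarith [this b a (le_of_not_ge hab)]
  have h := mul_le_mul_of_nonneg_left (exp_sub_exp_le b a) (sub_nonneg.2 hab)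
  have := mul_nonneg (sq_nonneg (a - b)) (Real.exp_pos b).le
  linarith

/-- Klein's inequality. -/
lemma trace_exp_sub_le_sub_trace_mul_exp_sub {A D : Matrix m m ℝ} (hA : A.IsHermitian)
    (hD : D.IsHermitian) :
    trace (NormedSpace.exp (A - D)) ≤
      trace (NormedSpace.exp A) - trace (D * NormedSpace.exp (A - D)) := by
  obtain ⟨a, b, q, hq, htr⟩ := exists_trace_sub_pow_mul_exp_eq hA (hA.sub hD)
  simp only [sub_sub_cancel] at htr
  have h₀ := htr 0 zero_le_two
  have h₁ := htr 1 one_le_two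
  simp only [pow_zero, pow_one, one_mul] at h₀ h₁
  rw [h₀.1, h₀.2, h₁.2]
  simp only [← Finset.sum_sub_distrib]
  refine Finset.sum_le_sum fun i _ => Finset.sum_le_sum fun j _ => ?_
  have := mul_le_mul_of_nonneg_left (exp_sub_exp_le (a i) (b j)) (hq i j)
  linarith

lemma trace_mul_exp_sub_trace_mul_exp_sub_le {A D : Matrix m m ℝ} (hA : A.IsHermitian)
    (hD : D.IsHermitian) :
    trace (D * NormedSpace.exp A) - trace (D * NormedSpace.exp (A - D)) ≤
      trace (D ^ 2 * NormedSpace.exp A) + trace (D ^ 2 * NormedSpace.exp (A - D)) := by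
  obtain ⟨a, b, q, hq, htr⟩ := exists_trace_sub_pow_mul_exp_eq hA (hA.sub hD)
  simp only [sub_sub_cancel] at htr
  have h₁ := htr 1 one_le_two
  simp only [pow_one] at h₁
  rw [h₁.1, h₁.2, (htr 2 le_rfl).1, (htr 2 le_rfl).2]
  simp only [← Finset.sum_sub_distrib, ← Finset.sum_add_distrib]
  refine Finset.sum_le_sum fun i _ => Finset.sum_le_sum fun j _ => ?_
  have := mul_le_mul_of_nonneg_left (sub_mul_exp_sub_exp_le (a i) (b j)) (hq i j)
  linarith

lemma trace_exp_sub_le {A D : Matrix m m ℝ} {ρ : ℝ} (hρ : 0 < ρ) (hA : A.IsHermitian)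
    (hD : D.PosSemidef) (hDρ : (ρ • 1 - D).PosSemidef) :
    trace (NormedSpace.exp (A - D)) ≤
      trace (NormedSpace.exp A) - (1 - 2 * ρ) * trace (D * NormedSpace.exp A) := by
  have hfirst := trace_exp_sub_le_sub_trace_mul_exp_sub hA hD.1
  have hchange := trace_mul_exp_sub_trace_mul_exp_sub_le hA hD.1
  have hsqA := trace_mul_self_mul_le hρ hD hDρ (posSemidef_exp hA)
  have hsqAD := trace_mul_self_mul_le hρ hD hDρ (posSemidef_exp (hA.sub hD.1))
  have hA₀ := trace_mul_nonneg hD (posSemidef_exp hA)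
  rcases le_total (trace (D * NormedSpace.exp (A - D))) (trace (D * NormedSpace.exp A)) with h | h
  · linarith [mul_le_mul_of_nonneg_left h hρ.le]
  · linarith [mul_nonneg hρ.le hA₀]

/-- Jensen's inequality for the spectral measure of `A` at `x`. -/
lemma exp_dotProduct_mulVec_le {A : Matrix m m ℝ} (hA : A.IsHermitian) {x : m → ℝ}
    (hx : x ⬝ᵥ x = 1) : Real.exp (x ⬝ᵥ A *ᵥ x) ≤ x ⬝ᵥ NormedSpace.exp A *ᵥ x := by
  obtain ⟨U, a, -, hU, hAdiag, hAexp⟩ := exists_orthogonal_diagonalization hA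
  have hquad (f : m → ℝ) :
      x ⬝ᵥ (U * diagonal f * Uᵀ) *ᵥ x = ∑ i, (Uᵀ *ᵥ x) i ^ 2 * f i := by
    rw [Matrix.mul_assoc, ← mulVec_mulVec, dotProduct_mulVec, ← mulVec_transpose, ← mulVec_mulVec]
    simp only [dotProduct, mulVec_diagonal]
    exact Finset.sum_congr rfl fun i _ => by ring
  have hmass : ∑ i, (Uᵀ *ᵥ x) i ^ 2 = 1 := by
    have := hquad fun _ => 1
    rw [diagonal_one, Matrix.mul_one, hU, one_mulVec, hx] at this
    simpa only [mul_one] using this.symm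
  rw [hAexp, hquad, hAdiag, hquad]
  exact convexOn_exp.map_sum_le (fun i _ => sq_nonneg _) hmass (fun _ _ => Set.mem_univ _)

end MatrixExponential

section EdgeSums

lemma sum_sum_sym2_mk {V M : Type*} [Fintype V] [AddCommMonoid M] {f : Sym2 V → M}
    [Fintype (Sym2 V)] (hf : ∀ v, f s(v, v) = 0) : ∑ u, ∑ v, f s(u, v) = 2 • ∑ e, f e := by
  classical
  rw [← Fintype.sum_prod_type', Finset.smul_sum,
    ← Finset.sum_fiberwise (s := Finset.univ) (g := fun x : V × V => s(x.1, x.2))]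
  refine Finset.sum_congr rfl fun e _ => ?_
  induction e with | _ a b => ?_
  rw [Finset.sum_congr rfl (g := fun _ => f s(a, b))
    (fun x hx => by rw [(Finset.mem_filter.1 hx).2]), Finset.sum_const]
  by_cases hab : a = b
  · subst hab
    simp only [hf, smul_zero]
  · have hfiber : (Finset.univ.filter fun x : V × V => s(x.1, x.2) = s(a, b)) =
        {(a, b), (b, a)} := by
      ext ⟨x, y⟩
      simp
    rw [hfiber, Finset.card_pair (by simp [hab])]

/-- The squared difference of the values of a potential `x` at the endpoints of an edge, which is
the quadratic form of the Laplacian of that edge. -/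
def sqDiff {V : Type*} (x : V → ℝ) (e : Sym2 V) : ℝ :=
  Sym2.lift ⟨fun i j => (x i - x j) ^ 2, fun i j => by ring⟩ e

variable {V : Type*}

@[simp] lemma sqDiff_mk (x : V → ℝ) (i j : V) : sqDiff x s(i, j) = (x i - x j) ^ 2 := rfl

end EdgeSums

section Laplacian

open Matrix

variable {n : ℕ}

lemma edgeLap_mk (i j : Fin n) : edgeLap s(i, j) =
    vecMulVec (Pi.single i (1 : ℝ) - Pi.single j 1) (Pi.single i (1 : ℝ) - Pi.single j 1) := rfl

@[simp] lemma edgeLap_diag (i : Fin n) : edgeLap s(i, i) = 0 := by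
  rw [edgeLap_mk, sub_self, zero_vecMulVec]

lemma edgeLap_posSemidef (e : Sym2 (Fin n)) : (edgeLap e).PosSemidef := by
  induction e with | _ i j => ?_
  simpa only [edgeLap_mk, star_trivial] using
    posSemidef_vecMulVec_self_star (Pi.single i (1 : ℝ) - Pi.single j 1 : Fin n → ℝ)

lemma dotProduct_edgeLap_mulVec (x : Fin n → ℝ) (e : Sym2 (Fin n)) :
    x ⬝ᵥ edgeLap e *ᵥ x = sqDiff x e := by
  induction e with | _ i j => ?_
  rw [edgeLap_mk, vecMulVec_mulVec, sqDiff_mk]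
  simp [dotProduct_sub, sub_dotProduct, sq]

lemma dotProduct_lap_mulVec (w : Weights n) (x : Fin n → ℝ) :
    x ⬝ᵥ lap w *ᵥ x = ∑ e, w e * sqDiff x e := by
  simp only [lap, sum_mulVec, dotProduct_sum, smul_mulVec, dotProduct_smul,
    dotProduct_edgeLap_mulVec, smul_eq_mul]

lemma lap_isHermitian (w : Weights n) : (lap w).IsHermitian :=
  isSelfAdjoint_sum _ fun e _ => (edgeLap_posSemidef e).1.smul (.all (w e))

lemma lap_posSemidef {w : Weights n} (hw : 0 ≤ w) : (lap w).PosSemidef :=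
  posSemidef_sum _ fun e _ => (edgeLap_posSemidef e).smul (hw e)

lemma lap_add (w w' : Weights n) : lap (w + w') = lap w + lap w' := by
  simp [lap, add_smul, Finset.sum_add_distrib]

lemma lap_smul (r : ℝ) (w : Weights n) : lap (r • w) = r • lap w := by
  simp [lap, Finset.smul_sum, smul_smul]

@[simp] lemma lap_zero : lap (0 : Weights n) = 0 := by simp [lap]

lemma lap_mulVec_one (w : Weights n) : lap w *ᵥ (1 : Fin n → ℝ) = 0 := by
  simp only [lap, sum_mulVec, smul_mulVec]
  refine Finset.sum_eq_zero fun e _ => ?_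
  induction e with | _ i j => ?_
  rw [edgeLap_mk, vecMulVec_mulVec]
  simp [sub_dotProduct]

lemma sum_sum_mul_sq {w : Weights n} (x : Fin n → ℝ) :
    ∑ i, ∑ j, w s(i, j) * x j ^ 2 = ∑ i, wdeg w i * x i ^ 2 := by
  rw [Finset.sum_comm]
  exact Finset.sum_congr rfl fun i _ => by
    simp only [wdeg, Finset.sum_mul, Sym2.eq_swap (b := i)]

lemma sum_mul_sqDiff_le {w : Weights n} (hw : 0 ≤ w) (x : Fin n → ℝ) :
    ∑ e, w e * sqDiff x e ≤ 2 * ∑ i, wdeg w i * x i ^ 2 := by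
  have hpair (i j : Fin n) : w s(i, j) * (x i - x j) ^ 2 ≤
      2 * (w s(i, j) * x i ^ 2) + 2 * (w s(i, j) * x j ^ 2) := by
    nlinarith [mul_nonneg (hw s(i, j)) (sq_nonneg (x i + x j))]
  have hle := Finset.sum_le_sum fun i (_ : i ∈ Finset.univ) =>
    Finset.sum_le_sum fun j (_ : j ∈ Finset.univ) => hpair i j
  have hedges := sum_sum_sym2_mk (f := fun e => w e * sqDiff x e) (by simp)
  simp only [sqDiff_mk, nsmul_eq_mul, Nat.cast_ofNat] at hedges
  simp only [hedges, Finset.sum_add_distrib, ← Finset.mul_sum, sum_sum_mul_sq,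
    ← Finset.sum_mul] at hle
  change _ ≤ 2 * ∑ i, wdeg w i * x i ^ 2 + _ at hle
  linarith

lemma smul_one_sub_lap_posSemidef {w : Weights n} {b : ℝ} (hw : 0 ≤ w)
    (hb : ∀ i, wdeg w i ≤ b) : ((2 * b) • 1 - lap w).PosSemidef := by
  refine PosSemidef.of_dotProduct_mulVec_nonneg
    ((isHermitian_one.smul (.all _)).sub (lap_isHermitian w)) fun x => ?_
  rw [star_trivial, sub_mulVec, dotProduct_sub, dotProduct_lap_mulVec, smul_mulVec,
    one_mulVec, dotProduct_smul, smul_eq_mul, sub_nonneg]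
  calc ∑ e, w e * sqDiff x e ≤ 2 * ∑ i, wdeg w i * x i ^ 2 := sum_mul_sqDiff_le hw x
    _ ≤ 2 * ∑ i, b * x i ^ 2 := by gcongr with i; exact hb i
    _ = 2 * b * (x ⬝ᵥ x) := by simp only [dotProduct, ← Finset.mul_sum, sq, mul_assoc]

lemma matInner_eq_trace {A B : Matrix (Fin n) (Fin n) ℝ} (hB : B.IsHermitian) :
    matInner A B = trace (A * B) := by
  simp only [matInner, trace, diag_apply, Matrix.mul_apply]
  refine Finset.sum_congr rfl fun i _ => Finset.sum_congr rfl fun j _ => ?_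
  rw [← hB.apply i j, star_trivial]

lemma matInner_smul_left (r : ℝ) (A B : Matrix (Fin n) (Fin n) ℝ) :
    matInner (r • A) B = r * matInner A B := by
  simp only [matInner, Finset.mul_sum, Matrix.smul_apply, smul_eq_mul, mul_assoc]

lemma matInner_smul_right (r : ℝ) (A B : Matrix (Fin n) (Fin n) ℝ) :
    matInner A (r • B) = r * matInner A B := by
  simp only [matInner, Finset.mul_sum, Matrix.smul_apply, smul_eq_mul, mul_left_comm]

lemma matInner_lap (w : Weights n) (B : Matrix (Fin n) (Fin n) ℝ) :
    matInner (lap w) B = ∑ e, w e * matInner (edgeLap e) B := by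
  simp only [matInner, lap, Matrix.sum_apply, Matrix.smul_apply, smul_eq_mul, Finset.sum_mul,
    Finset.mul_sum, mul_assoc]
  rw [Finset.sum_congr rfl fun i _ => Finset.sum_comm, Finset.sum_comm]

lemma matInner_nonneg {A B : Matrix (Fin n) (Fin n) ℝ} (hA : A.PosSemidef) (hB : B.PosSemidef) :
    0 ≤ matInner A B := by
  rw [matInner_eq_trace hB.1]
  exact trace_mul_nonneg hA hB

/-- The orthogonal projection of `x` to the complement of the all-ones vector, that is, the
deviation of `x` from its mean. -/
noncomputable def center (x : Fin n → ℝ) : Fin n → ℝ := fun i => x i - (∑ j, x j) / n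

lemma sum_center (x : Fin n → ℝ) : ∑ i, center x i = 0 := by
  rcases n.eq_zero_or_pos with rfl | hn
  · simp
  · simp only [center, Finset.sum_sub_distrib, Finset.sum_const, Finset.card_univ,
      Fintype.card_fin, nsmul_eq_mul]
    field_simp
    ring

lemma sqDiff_center (x : Fin n → ℝ) (e : Sym2 (Fin n)) : sqDiff (center x) e = sqDiff x e := by
  induction e with | _ i j => simp [center]

lemma dotProduct_center {x : Fin n → ℝ} (hx : ∑ i, x i = 0) (y : Fin n → ℝ) :
    x ⬝ᵥ center y = x ⬝ᵥ y := by
  simp only [dotProduct, center, mul_sub, Finset.sum_sub_distrib, ← Finset.sum_mul, hx, zero_mul,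
    sub_zero]

lemma projPerpOnes_mulVec (x : Fin n → ℝ) : projPerpOnes n *ᵥ x = center x := by
  ext i
  simp only [projPerpOnes, sub_mulVec, one_mulVec, Pi.sub_apply, center]
  simp [mulVec, dotProduct, Finset.mul_sum, div_eq_inv_mul]

lemma dotProduct_projPerpOnes_mulVec (x : Fin n → ℝ) :
    x ⬝ᵥ projPerpOnes n *ᵥ x = center x ⬝ᵥ center x := by
  rw [projPerpOnes_mulVec, dotProduct_center (sum_center x), dotProduct_comm]

lemma projPerpOnes_isHermitian : (projPerpOnes n).IsHermitian :=
  isHermitian_one.sub (by ext i j; simp)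

lemma projPerpOnes_posSemidef : (projPerpOnes n).PosSemidef := by
  refine PosSemidef.of_dotProduct_mulVec_nonneg projPerpOnes_isHermitian fun x => ?_
  rw [star_trivial, dotProduct_projPerpOnes_mulVec]
  exact Finset.sum_nonneg fun i _ => mul_self_nonneg _

lemma projPerpOnes_sub_vecMulVec_posSemidef {x : Fin n → ℝ} (hx : x ⬝ᵥ x = 1)
    (hx₀ : ∑ i, x i = 0) : (projPerpOnes n - vecMulVec x x).PosSemidef := by
  have hxx : (vecMulVec x x).IsHermitian := (posSemidef_vecMulVec_self_star x).1
  refine PosSemidef.of_dotProduct_mulVec_nonneg (projPerpOnes_isHermitian.sub hxx) fun y => ?_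
  have hcs := Finset.sum_mul_sq_le_sq_mul_sq Finset.univ x (center y)
  simp only [sq (x _), sq (center y _)] at hcs
  change (x ⬝ᵥ center y) ^ 2 ≤ (x ⬝ᵥ x) * (center y ⬝ᵥ center y) at hcs
  rw [hx, one_mul, dotProduct_center hx₀] at hcs
  rw [star_trivial, sub_mulVec, dotProduct_sub, dotProduct_projPerpOnes_mulVec, vecMulVec_mulVec,
    op_smul_eq_smul, dotProduct_smul, dotProduct_comm y x, smul_eq_mul, ← sq]
  exact sub_nonneg.2 hcs

lemma dotProduct_mulVec_le_matInner_projPerpOnes {M : Matrix (Fin n) (Fin n) ℝ}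
    (hM : M.PosSemidef) {x : Fin n → ℝ} (hx : x ⬝ᵥ x = 1) (hx₀ : ∑ i, x i = 0) :
    x ⬝ᵥ M *ᵥ x ≤ matInner (projPerpOnes n) M := by
  have h := trace_mul_nonneg (projPerpOnes_sub_vecMulVec_posSemidef hx hx₀) hM
  rw [Matrix.sub_mul, trace_sub, sub_nonneg, vecMulVec_mul, trace_vecMulVec,
    ← mulVec_transpose, ← conjTranspose_eq_transpose_of_trivial, hM.1.eq] at h
  rwa [matInner_eq_trace hM.1]

lemma lap_one (hn : n ≠ 0) : lap (1 : Weights n) = (n : ℝ) • projPerpOnes n := by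
  ext a b
  have hn' : (n : ℝ) ≠ 0 := Nat.cast_ne_zero.2 hn
  have h := sum_sum_sym2_mk (f := fun e => edgeLap e a b) (by simp)
  have hlap : lap (1 : Weights n) a b = ∑ e, edgeLap e a b := by simp [lap, Matrix.sum_apply]
  rw [hlap, ← mul_right_inj' (two_ne_zero' ℝ), ← Nat.cast_ofNat (R := ℝ), ← nsmul_eq_mul, ← h]
  simp only [edgeLap_mk, vecMulVec_apply, Pi.sub_apply, Pi.single_apply, projPerpOnes, one_apply,
    Matrix.smul_apply, Matrix.sub_apply, of_apply, smul_eq_mul, sub_mul, mul_sub,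
    Finset.sum_sub_distrib]
  by_cases hab : a = b
  · subst hab
    simp only [mul_ite, mul_one, mul_zero, Finset.sum_ite_irrel, Finset.sum_const,
      Finset.card_univ, Fintype.card_fin, nsmul_eq_mul, Finset.sum_ite_eq, Finset.mem_univ,
      ↓reduceIte, Nat.cast_ofNat, one_div]
    field_simp
    ring
  · simp only [mul_ite, mul_one, mul_zero, Finset.sum_ite_irrel, Finset.sum_const,
      Finset.card_univ, Fintype.card_fin, nsmul_eq_mul, Finset.sum_ite_eq, Finset.mem_univ,
      ↓reduceIte, hab, zero_sub, sub_zero, Nat.cast_ofNat, one_div]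
    field_simp
    norm_num

lemma matInner_lap_one (hn : n ≠ 0) (B : Matrix (Fin n) (Fin n) ℝ) :
    matInner (lap 1) B = n * matInner (projPerpOnes n) B := by
  rw [lap_one hn, matInner_smul_left]

end Laplacian

section Potential

open Matrix

variable {n : ℕ}

lemma exp_mulVec_of_mulVec_eq_zero {m : Type*} [Fintype m] [DecidableEq m] {A : Matrix m m ℝ}
    (hA : A.IsHermitian) {v : m → ℝ} (hv : A *ᵥ v = 0) : NormedSpace.exp A *ᵥ v = v := by
  obtain ⟨U, a, hU, hU', hAdiag, hAexp⟩ := exists_orthogonal_diagonalization hA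
  have hdiag : diagonal a *ᵥ (Uᵀ *ᵥ v) = 0 := by
    have := congrArg (Uᵀ *ᵥ ·) hv
    simpa [hAdiag, ← Matrix.mul_assoc, hU] using this
  have hexp : diagonal (fun i => Real.exp (a i)) *ᵥ (Uᵀ *ᵥ v) = Uᵀ *ᵥ v := by
    ext i
    have := congrFun hdiag i
    rw [mulVec_diagonal, Pi.zero_apply, mul_eq_zero] at this
    rw [mulVec_diagonal]
    rcases this with h | h <;> simp [h]
  rw [hAexp, Matrix.mul_assoc, ← mulVec_mulVec, ← mulVec_mulVec, hexp, mulVec_mulVec, hU',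
    one_mulVec]

lemma matInner_projPerpOnes (hn : n ≠ 0) {B : Matrix (Fin n) (Fin n) ℝ}
    (hB : B *ᵥ 1 = 1) : matInner (projPerpOnes n) B = trace B - 1 := by
  have hrow (i : Fin n) : ∑ j, B i j = 1 := by
    simpa [mulVec, dotProduct] using congrFun hB i
  simp only [matInner, projPerpOnes, Matrix.sub_apply, of_apply, sub_mul, Finset.sum_sub_distrib,
    ← Finset.mul_sum, hrow, one_apply, ite_mul, one_mul, zero_mul, Finset.sum_ite_eq,
    Finset.mem_univ, if_true, trace, diag_apply]
  simp [hn]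

lemma neg_smul_lap_isHermitian (s : ℝ) (w : Weights n) : (-s • lap w).IsHermitian :=
  (lap_isHermitian w).smul (.all _)

/-- The potential `⟨Π, exp(-s L_w)⟩` of the multiplicative weights analysis: its logarithm bounds
the objective at `w` from below. -/
noncomputable def potential (s : ℝ) (w : Weights n) : ℝ :=
  matInner (projPerpOnes n) (NormedSpace.exp (-s • lap w))

lemma potential_eq_trace (hn : n ≠ 0) (s : ℝ) (w : Weights n) :
    potential s w = trace (NormedSpace.exp (-s • lap w)) - 1 := by
  refine matInner_projPerpOnes hn
    (exp_mulVec_of_mulVec_eq_zero (neg_smul_lap_isHermitian s w) ?_)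
  rw [smul_mulVec, lap_mulVec_one, smul_zero]

lemma potential_zero_weights (hn : n ≠ 0) (s : ℝ) : potential s (0 : Weights n) = n - 1 := by
  rw [potential_eq_trace hn]
  simp

lemma exists_unit_sum_eq_zero (hn : 2 ≤ n) : ∃ x : Fin n → ℝ, x ⬝ᵥ x = 1 ∧ ∑ i, x i = 0 := by
  obtain ⟨m, rfl⟩ := Nat.exists_eq_add_of_le' hn
  refine ⟨(√2)⁻¹ • (Pi.single 0 1 - Pi.single 1 1), ?_, ?_⟩
  · have h : (√2 : ℝ)⁻¹ * ((√2)⁻¹ * 2) = 1 := by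
      rw [← mul_assoc, ← mul_inv, Real.mul_self_sqrt zero_le_two, inv_mul_cancel₀ two_ne_zero]
    simp only [dotProduct_smul, smul_dotProduct, smul_eq_mul, sub_dotProduct, dotProduct_sub,
      single_one_dotProduct]
    simpa [mul_two] using h
  · simp [← Finset.mul_sum, Finset.sum_sub_distrib]

lemma exp_dotProduct_mulVec_le_matInner {A : Matrix (Fin n) (Fin n) ℝ} (hA : A.IsHermitian)
    {x : Fin n → ℝ} (hx : x ⬝ᵥ x = 1) (hx₀ : ∑ i, x i = 0) :
    Real.exp (x ⬝ᵥ A *ᵥ x) ≤ matInner (projPerpOnes n) (NormedSpace.exp A) :=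
  (exp_dotProduct_mulVec_le hA hx).trans
    (dotProduct_mulVec_le_matInner_projPerpOnes (posSemidef_exp hA) hx hx₀)

lemma matInner_projPerpOnes_exp_pos (hn : 2 ≤ n) {A : Matrix (Fin n) (Fin n) ℝ}
    (hA : A.IsHermitian) : 0 < matInner (projPerpOnes n) (NormedSpace.exp A) := by
  obtain ⟨x, hx, hx₀⟩ := exists_unit_sum_eq_zero hn
  exact (Real.exp_pos _).trans_le (exp_dotProduct_mulVec_le_matInner hA hx hx₀)

lemma potential_pos (hn : 2 ≤ n) (s : ℝ) (w : Weights n) : 0 < potential s w :=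
  matInner_projPerpOnes_exp_pos hn (neg_smul_lap_isHermitian s w)

lemma inv_smul_exp_mem_specSet (hn : 2 ≤ n) {A : Matrix (Fin n) (Fin n) ℝ} (hA : A.IsHermitian) :
    (matInner (projPerpOnes n) (NormedSpace.exp A))⁻¹ • NormedSpace.exp A ∈ specSet n := by
  have h := matInner_projPerpOnes_exp_pos hn hA
  exact ⟨(posSemidef_exp hA).smul (inv_nonneg.2 h.le), by
    rw [matInner_smul_right, inv_mul_cancel₀ h.ne']⟩

lemma specSet_nonempty (hn : 2 ≤ n) : (specSet n).Nonempty :=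
  ⟨_, inv_smul_exp_mem_specSet hn isHermitian_zero⟩

lemma objective_le {w : Weights n} (hw : 0 ≤ w) {X : Matrix (Fin n) (Fin n) ℝ}
    (hX : X ∈ specSet n) : objective w ≤ matInner (lap w) X := by
  refine csInf_le ⟨0, ?_⟩ ⟨X, hX, rfl⟩
  rintro _ ⟨Y, hY, rfl⟩
  exact matInner_nonneg (lap_posSemidef hw) hY.1

lemma objective_nonneg {w : Weights n} (hw : 0 ≤ w) : 0 ≤ objective w := by
  refine Real.sInf_nonneg ?_
  rintro _ ⟨Y, hY, rfl⟩
  exact matInner_nonneg (lap_posSemidef hw) hY.1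

lemma le_objective_of_posSemidef (hn : 2 ≤ n) {w : Weights n} {r : ℝ}
    (h : (lap w - r • projPerpOnes n).PosSemidef) : r ≤ objective w := by
  refine le_csInf ((specSet_nonempty hn).image _) ?_
  rintro _ ⟨X, hX, rfl⟩
  have htr := trace_mul_nonneg h hX.1
  rwa [Matrix.sub_mul, Matrix.smul_mul, trace_sub, trace_smul, ← matInner_eq_trace hX.1.1,
    ← matInner_eq_trace hX.1.1, hX.2, smul_eq_mul, mul_one, sub_nonneg] at htr

lemma mul_dotProduct_self_le_of_forall_unit {w : Weights n} {r : ℝ}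
    (h : ∀ x : Fin n → ℝ, x ⬝ᵥ x = 1 → ∑ i, x i = 0 → r ≤ x ⬝ᵥ lap w *ᵥ x)
    {z : Fin n → ℝ} (hz : ∑ i, z i = 0) : r * (z ⬝ᵥ z) ≤ z ⬝ᵥ lap w *ᵥ z := by
  rcases eq_or_ne z 0 with rfl | hz₀
  · simp
  have hzz : 0 < z ⬝ᵥ z := by simpa using dotProduct_self_star_pos_iff.2 hz₀
  have hscale : (√(z ⬝ᵥ z))⁻¹ * (√(z ⬝ᵥ z))⁻¹ = (z ⬝ᵥ z)⁻¹ := by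
    rw [← mul_inv, Real.mul_self_sqrt hzz.le]
  have hunit := h ((√(z ⬝ᵥ z))⁻¹ • z)
    (by rw [dotProduct_smul, smul_dotProduct, smul_smul, hscale, smul_eq_mul,
      inv_mul_cancel₀ hzz.ne'])
    (by simp only [Pi.smul_apply, smul_eq_mul, ← Finset.mul_sum, hz, mul_zero])
  rwa [mulVec_smul, dotProduct_smul, smul_dotProduct, smul_smul, hscale, smul_eq_mul,
    inv_mul_eq_div, le_div_iff₀ hzz] at hunit

lemma le_objective_of_forall_unit (hn : 2 ≤ n) {w : Weights n} {r : ℝ}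
    (h : ∀ x : Fin n → ℝ, x ⬝ᵥ x = 1 → ∑ i, x i = 0 → r ≤ x ⬝ᵥ lap w *ᵥ x) :
    r ≤ objective w := by
  refine le_objective_of_posSemidef hn (PosSemidef.of_dotProduct_mulVec_nonneg
    ((lap_isHermitian w).sub (projPerpOnes_isHermitian.smul (.all r))) fun y => ?_)
  have hcenter : y ⬝ᵥ lap w *ᵥ y = center y ⬝ᵥ lap w *ᵥ center y := by
    simp only [dotProduct_lap_mulVec, sqDiff_center]
  rw [star_trivial, sub_mulVec, dotProduct_sub, smul_mulVec, dotProduct_smul,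
    dotProduct_projPerpOnes_mulVec, smul_eq_mul, sub_nonneg, hcenter]
  exact mul_dotProduct_self_le_of_forall_unit h (sum_center y)

lemma neg_log_potential_le (hn : 2 ≤ n) {s : ℝ} (hs : 0 < s) (w : Weights n) :
    -Real.log (potential s w) ≤ s * objective w := by
  rw [← div_le_iff₀' hs]
  refine le_objective_of_forall_unit hn fun x hx hx₀ => ?_
  have h : _ ≤ potential s w :=
    exp_dotProduct_mulVec_le_matInner (neg_smul_lap_isHermitian s w) hx hx₀
  rw [← Real.le_log_iff_exp_le (potential_pos hn s w), smul_mulVec, dotProduct_smul,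
    smul_eq_mul] at h
  rw [div_le_iff₀' hs]
  linarith

lemma potential_add_le (hn : n ≠ 0) {s b : ℝ} (hs : 0 < s) (hb : 0 < b) (w : Weights n)
    {v : Weights n} (hv : 0 ≤ v) (hvb : ∀ i, wdeg v i ≤ b) :
    potential s (w + v) ≤ potential s w -
      (1 - 4 * b * s) * (s * matInner (lap v) (NormedSpace.exp (-s • lap w))) := by
  have hA := neg_smul_lap_isHermitian s w
  have hDρ : ((2 * b * s) • 1 - s • lap v).PosSemidef := by
    have := (smul_one_sub_lap_posSemidef hv hvb).smul hs.le
    rwa [smul_sub, smul_smul, mul_comm s] at this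
  have h := trace_exp_sub_le (by positivity) hA ((lap_posSemidef hv).smul hs.le) hDρ
  rw [Matrix.smul_mul, trace_smul, smul_eq_mul] at h
  rw [potential_eq_trace hn, potential_eq_trace hn, matInner_eq_trace (posSemidef_exp hA).1,
    lap_add, smul_add, neg_smul s (lap v), ← sub_eq_add_neg]
  linarith

lemma potential_add_le_sub_matInner_exp_add (hn : n ≠ 0) (s : ℝ) (w v : Weights n) :
    potential s (w + v) ≤ potential s w -
      s * matInner (lap v) (NormedSpace.exp (-s • lap (w + v))) := by
  have h := trace_exp_sub_le_sub_trace_mul_exp_sub (neg_smul_lap_isHermitian s w)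
    ((lap_isHermitian v).smul (.all s))
  have hadd : -s • lap w - s • lap v = -s • lap (w + v) := by
    rw [lap_add, smul_add, neg_smul s (lap v), sub_eq_add_neg]
  rw [hadd, Matrix.smul_mul, trace_smul, smul_eq_mul] at h
  rw [potential_eq_trace hn, potential_eq_trace hn,
    matInner_eq_trace (posSemidef_exp (neg_smul_lap_isHermitian s _)).1]
  linarith

end Potential

section BernoulliSubsets

variable {α : Type*}

/-- The expectation of `φ S`, where `S` is a random subset of `E` that contains each element
independently with probability `q`. It is a finite sum so that it can be differentiated in `q`. -/
noncomputable def bernoulliMean (E : Finset α) (q : ℝ) (φ : Set α → ℝ) : ℝ :=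
  ∑ S ∈ E.powerset, q ^ S.card * (1 - q) ^ (E.card - S.card) * φ S

lemma bernoulliMean_insert [DecidableEq α] {E : Finset α} {a : α} (ha : a ∉ E) (q : ℝ)
    (φ : Set α → ℝ) : bernoulliMean (insert a E) q φ =
      (1 - q) * bernoulliMean E q φ + q * bernoulliMean E q (fun S => φ (insert a S)) := by
  unfold bernoulliMean
  rw [Finset.sum_powerset_insert ha, Finset.mul_sum, Finset.mul_sum]
  congr 1 <;> refine Finset.sum_congr rfl fun S hS => ?_
  · have := Finset.card_le_card (Finset.mem_powerset.1 hS)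
    rw [Finset.card_insert_of_notMem ha, Nat.succ_sub this, pow_succ]
    ring
  · rw [Finset.card_insert_of_notMem ha,
      Finset.card_insert_of_notMem fun h => ha (Finset.mem_powerset.1 hS h), Nat.add_sub_add_right,
      pow_succ, Finset.coe_insert]
    ring

lemma bernoulliMean_congr {E : Finset α} {q : ℝ} {φ ψ : Set α → ℝ}
    (h : ∀ S ⊆ (E : Set α), φ S = ψ S) : bernoulliMean E q φ = bernoulliMean E q ψ :=
  Finset.sum_congr rfl fun S hS => by rw [h S (Finset.coe_subset.2 (Finset.mem_powerset.1 hS))]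

lemma bernoulliMean_mono (E : Finset α) {q : ℝ} (hq₀ : 0 ≤ q) (hq₁ : q ≤ 1) {φ ψ : Set α → ℝ}
    (h : φ ≤ ψ) : bernoulliMean E q φ ≤ bernoulliMean E q ψ :=
  Finset.sum_le_sum fun S _ => mul_le_mul_of_nonneg_left (h S)
    (mul_nonneg (pow_nonneg hq₀ _) (pow_nonneg (sub_nonneg.2 hq₁) _))

lemma bernoulliMean_sub (E : Finset α) (q : ℝ) (φ ψ : Set α → ℝ) :
    bernoulliMean E q (fun S => φ S - ψ S) = bernoulliMean E q φ - bernoulliMean E q ψ := by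
  simp only [bernoulliMean, mul_sub, Finset.sum_sub_distrib]

lemma bernoulliMean_const_mul (E : Finset α) (q c : ℝ) (φ : Set α → ℝ) :
    bernoulliMean E q (fun S => c * φ S) = c * bernoulliMean E q φ := by
  simp only [bernoulliMean, Finset.mul_sum, mul_left_comm]

lemma bernoulliMean_sum {ι : Type*} (s : Finset ι) (E : Finset α) (q : ℝ) (φ : ι → Set α → ℝ) :
    bernoulliMean E q (fun S => ∑ i ∈ s, φ i S) = ∑ i ∈ s, bernoulliMean E q (φ i) := by
  simp only [bernoulliMean, Finset.mul_sum]
  exact Finset.sum_comm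

lemma bernoulliMean_zero (E : Finset α) (φ : Set α → ℝ) : bernoulliMean E 0 φ = φ ∅ := by
  unfold bernoulliMean
  rw [Finset.sum_eq_single ∅]
  · simp
  · intro S _ hS
    rw [zero_pow (Finset.card_ne_zero.2 (Finset.nonempty_iff_ne_empty.2 hS)), zero_mul, zero_mul]
  · simp

lemma bernoulliMean_insert_sub_sdiff_self {E : Finset α} {a : α} (ha : a ∉ E) (q : ℝ)
    (φ : Set α → ℝ) : bernoulliMean E q (fun S => φ (insert a S) - φ (S \ {a})) =
      bernoulliMean E q (fun S => φ (insert a S)) - bernoulliMean E q φ := by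
  rw [← bernoulliMean_sub]
  exact bernoulliMean_congr fun S hS => by rw [Set.sdiff_singleton_eq_self fun h => ha (hS h)]

/-- Russo's formula. -/
lemma hasDerivAt_bernoulliMean (E : Finset α) (φ : Set α → ℝ) (q : ℝ) :
    HasDerivAt (fun q => bernoulliMean E q φ)
      (∑ e ∈ E, bernoulliMean E q fun S => φ (insert e S) - φ (S \ {e})) q := by
  classical
  induction E using Finset.induction_on generalizing φ with
  | empty => simpa [bernoulliMean] using hasDerivAt_const q (φ ∅)
  | insert a E ha ih =>
    have hderiv := (((hasDerivAt_id q).const_sub 1).mul (ih φ)).add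
      ((hasDerivAt_id q).mul (ih fun S => φ (insert a S)))
    have hnew : bernoulliMean (insert a E) q (fun S => φ (insert a S) - φ (S \ {a})) =
        bernoulliMean E q (fun S => φ (insert a S)) - bernoulliMean E q φ := by
      rw [bernoulliMean_insert ha]
      simp only [Set.insert_idem, Set.insert_sdiff_of_mem _ (Set.mem_singleton a)]
      rw [bernoulliMean_insert_sub_sdiff_self ha]
      ring
    have hold : ∀ e ∈ E, bernoulliMean (insert a E) q (fun S => φ (insert e S) - φ (S \ {e})) =
        (1 - q) * bernoulliMean E q (fun S => φ (insert e S) - φ (S \ {e})) +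
        q * bernoulliMean E q (fun S => φ (insert a (insert e S)) - φ (insert a (S \ {e}))) := by
      intro e he
      have hae : a ∉ ({e} : Set α) := fun h => ha (Set.mem_singleton_iff.1 h ▸ he)
      simp only [bernoulliMean_insert ha, Set.insert_comm e a, Set.insert_sdiff_of_notMem _ hae]
    rw [funext fun q => bernoulliMean_insert ha q φ, Finset.sum_insert ha, hnew,
      Finset.sum_congr rfl hold, Finset.sum_add_distrib, ← Finset.mul_sum, ← Finset.mul_sum]
    exact hderiv.congr_deriv (by simp only [id]; ring)

/-- Russo's formula turns a bound on the total influence into a differential inequality in `q`. -/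
lemma bernoulliMean_le_exp_mul {E : Finset α} {φ : Set α → ℝ} {κ : ℝ}
    (h : ∀ S, ∑ e ∈ E, (φ (insert e S) - φ (S \ {e})) ≤ κ * φ S) {p : ℝ} (hp₀ : 0 ≤ p)
    (hp₁ : p ≤ 1) : bernoulliMean E p φ ≤ Real.exp (κ * p) * φ ∅ := by
  have hderiv (q : ℝ) : HasDerivAt (fun q => Real.exp (-(κ * q)) * bernoulliMean E q φ)
      (Real.exp (-(κ * q)) *
        ((∑ e ∈ E, bernoulliMean E q fun S => φ (insert e S) - φ (S \ {e})) -
          κ * bernoulliMean E q φ)) q := by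
    have hexp : HasDerivAt (fun q => Real.exp (-(κ * q))) (Real.exp (-(κ * q)) * -(κ * 1)) q :=
      ((hasDerivAt_id q).const_mul κ).neg.exp
    exact (hexp.mul (hasDerivAt_bernoulliMean E φ q)).congr_deriv (by ring)
  have hanti : AntitoneOn (fun q => Real.exp (-(κ * q)) * bernoulliMean E q φ) (Set.Icc 0 1) := by
    refine antitoneOn_of_deriv_nonpos (convex_Icc 0 1)
      (fun q _ => (hderiv q).continuousAt.continuousWithinAt)
      (fun q _ => (hderiv q).differentiableAt.differentiableWithinAt) fun q hq => ?_
    rw [interior_Icc] at hq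
    rw [(hderiv q).deriv, ← bernoulliMean_sum, ← bernoulliMean_const_mul]
    exact mul_nonpos_of_nonneg_of_nonpos (Real.exp_pos _).le
      (sub_nonpos.2 (bernoulliMean_mono E hq.1.le hq.2.le h))
  have hle := hanti (Set.left_mem_Icc.2 zero_le_one) ⟨hp₀, hp₁⟩ hp₀
  simp only [mul_zero, neg_zero, Real.exp_zero, one_mul, bernoulliMean_zero] at hle
  rwa [Real.exp_neg, inv_mul_le_iff₀ (Real.exp_pos _)] at hle

end BernoulliSubsets

section RandomGraph

open Matrix

instance {V : Type*} [Countable V] : MeasurableSingletonClass (SimpleGraph V) where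
  measurableSet_singleton G := by
    rw [← Set.preimage_image_eq {G} SimpleGraph.edgeSet_injective, Set.image_singleton]
    exact SimpleGraph.measurable_edgeSet (measurableSet_singleton _)

lemma integral_edgeSet_binomialRandom {V : Type*} [Fintype V] [DecidableEq V] (p : unitInterval)
    (φ : Set (Sym2 V) → ℝ) : ∫ G, φ G.edgeSet ∂SimpleGraph.binomialRandom V p =
      bernoulliMean (⊤ : SimpleGraph V).edgeFinset p φ := by
  classical
  have hsingleton (G : SimpleGraph V) : (SimpleGraph.binomialRandom V p).real {G} =
      p ^ G.edgeFinset.card * (1 - p) ^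
        ((⊤ : SimpleGraph V).edgeFinset.card - G.edgeFinset.card) := by
    rw [measureReal_def, SimpleGraph.binomialRandom_singleton,
      SimpleGraph.card_edgeFinset_top_eq_card_choose_two, Nat.card_eq_fintype_card,
      ← SimpleGraph.coe_edgeFinset, Set.ncard_coe_finset]
    simp
  rw [integral_fintype .of_finite, bernoulliMean]
  refine Finset.sum_nbij' (fun G => G.edgeFinset) (fun S => SimpleGraph.fromEdgeSet S)
    (fun G _ => Finset.mem_powerset.2 (SimpleGraph.edgeFinset_mono le_top))
    (fun _ _ => Finset.mem_univ _) (fun G _ => by simp) (fun S hS => ?_) fun G _ => ?_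
  · rw [Finset.mem_powerset, ← Finset.coe_subset, SimpleGraph.coe_edgeFinset,
      SimpleGraph.edgeSet_top] at hS
    rw [← Finset.coe_inj, SimpleGraph.coe_edgeFinset, SimpleGraph.edgeSet_fromEdgeSet]
    exact sdiff_eq_left.2 (Set.subset_compl_iff_disjoint_right.1 hS)
  · rw [hsingleton, smul_eq_mul, SimpleGraph.coe_edgeFinset]

variable {n : ℕ}

/-- The weighting that is `1` on `S` and `0` elsewhere, i.e. the unweighted graph with edge set
`S`. -/
noncomputable def indWeights (S : Set (Sym2 (Fin n))) : Weights n := S.indicator 1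

lemma indWeights_nonneg (S : Set (Sym2 (Fin n))) : 0 ≤ indWeights S :=
  Set.indicator_nonneg fun _ _ => zero_le_one

lemma indWeights_mono {S T : Set (Sym2 (Fin n))} (h : S ⊆ T) : indWeights S ≤ indWeights T :=
  Set.indicator_le_indicator_of_subset h fun _ => zero_le_one

lemma indWeights_insert (S : Set (Sym2 (Fin n))) (e : Sym2 (Fin n)) :
    indWeights (insert e S) = indWeights (S \ {e}) + indWeights {e} := by
  rw [← Set.insert_sdiff_singleton, ← Set.union_singleton]
  exact Set.indicator_union_of_disjoint Set.disjoint_sdiff_left 1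

@[simp] lemma indWeights_empty : indWeights (∅ : Set (Sym2 (Fin n))) = 0 := Set.indicator_empty _

lemma lap_indWeights_singleton (e : Sym2 (Fin n)) : lap (indWeights {e}) = edgeLap e := by
  classical
  simp [lap, indWeights, Set.indicator_apply]

lemma wdeg_add (w w' : Weights n) (i : Fin n) : wdeg (w + w') i = wdeg w i + wdeg w' i := by
  simp [wdeg, Finset.sum_add_distrib]

lemma wdeg_mono {w w' : Weights n} (h : w ≤ w') (i : Fin n) : wdeg w i ≤ wdeg w' i :=
  Finset.sum_le_sum fun _ _ => h _

lemma wdeg_indWeights_singleton (e : Sym2 (Fin n)) (i : Fin n) [Decidable (i ∈ e)] :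
    wdeg (indWeights {e}) i = if i ∈ e then 1 else 0 := by
  classical
  unfold wdeg indWeights
  split_ifs with h
  · obtain ⟨k, rfl⟩ := h
    simp only [Set.indicator_apply, Set.mem_singleton_iff, Sym2.congr_right, Pi.one_apply,
      Finset.sum_ite_eq', Finset.mem_univ, if_true]
  · refine Finset.sum_eq_zero fun j _ => Set.indicator_of_notMem ?_ _
    rintro rfl
    exact h (Sym2.mem_mk_left i j)

lemma sum_wdeg_indWeights_singleton_le (E : Finset (Sym2 (Fin n))) (i : Fin n) :
    ∑ e ∈ E, wdeg (indWeights {e}) i ≤ n := by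
  classical
  have hpair (j : Fin n) : ∑ e ∈ E, indWeights {e} s(i, j) ≤ (1 : ℝ) := by
    simp only [indWeights, Set.indicator_apply, Set.mem_singleton_iff, Pi.one_apply,
      Finset.sum_ite_eq]
    split_ifs <;> norm_num
  calc ∑ e ∈ E, wdeg (indWeights {e}) i = ∑ j, ∑ e ∈ E, indWeights {e} s(i, j) := Finset.sum_comm
    _ ≤ ∑ _j : Fin n, (1 : ℝ) := Finset.sum_le_sum fun j _ => hpair j
    _ = n := by simp

lemma potential_insert_sub_sdiff_le (hn : n ≠ 0) {s : ℝ} (hs : 0 < s) (S : Set (Sym2 (Fin n)))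
    (e : Sym2 (Fin n)) :
    potential s (indWeights (insert e S)) - potential s (indWeights (S \ {e})) ≤
      -((1 - 4 * s) * s) *
        matInner (edgeLap e) (NormedSpace.exp (-s • lap (indWeights S))) := by
  classical
  have hnonneg := matInner_nonneg (edgeLap_posSemidef e)
    (posSemidef_exp (neg_smul_lap_isHermitian s (indWeights S)))
  by_cases he : e ∈ S
  · have h := potential_add_le_sub_matInner_exp_add hn s (indWeights (S \ {e})) (indWeights {e})
    rw [← indWeights_insert, Set.insert_eq_of_mem he, lap_indWeights_singleton] at h
    rw [Set.insert_eq_of_mem he]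
    nlinarith [mul_nonneg (mul_self_nonneg s) hnonneg]
  · have h := potential_add_le hn hs one_pos (indWeights S) (indWeights_nonneg {e}) fun i => by
      rw [wdeg_indWeights_singleton]; split_ifs <;> norm_num
    rw [lap_indWeights_singleton] at h
    rw [indWeights_insert, Set.sdiff_singleton_eq_self he]
    linarith

lemma sum_matInner_edgeLap (hn : n ≠ 0) (B : Matrix (Fin n) (Fin n) ℝ) :
    ∑ e ∈ (⊤ : SimpleGraph (Fin n)).edgeFinset, matInner (edgeLap e) B =
      n * matInner (projPerpOnes n) B := by
  rw [← matInner_lap_one hn, matInner_lap, Finset.sum_subset (Finset.subset_univ _)]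
  · simp
  · intro e _ he
    induction e with | _ i j => ?_
    obtain rfl : i = j := by simpa using he
    simp [matInner]

lemma bernoulliMean_potential_le (hn : n ≠ 0) {s : ℝ} (hs : 0 < s) {p : ℝ} (hp₀ : 0 ≤ p)
    (hp₁ : p ≤ 1) : bernoulliMean (⊤ : SimpleGraph (Fin n)).edgeFinset p
      (fun S => potential s (indWeights S)) ≤
      Real.exp (-((1 - 4 * s) * s) * n * p) * (n - 1) := by
  have hinfluence (S : Set (Sym2 (Fin n))) :
      ∑ e ∈ (⊤ : SimpleGraph (Fin n)).edgeFinset,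
        (potential s (indWeights (insert e S)) - potential s (indWeights (S \ {e}))) ≤
      -((1 - 4 * s) * s) * n * potential s (indWeights S) := by
    rw [mul_assoc _ (n : ℝ), potential.eq_1 s (indWeights S), ← sum_matInner_edgeLap hn,
      Finset.mul_sum]
    exact Finset.sum_le_sum fun e _ => potential_insert_sub_sdiff_le hn hs S e
  have h := bernoulliMean_le_exp_mul (φ := fun S => potential s (indWeights S)) hinfluence hp₀ hp₁
  rwa [indWeights_empty, potential_zero_weights hn] at h

lemma two_rpow_wdeg_insert_sub_sdiff_le (S : Set (Sym2 (Fin n))) (e : Sym2 (Fin n)) (i : Fin n) :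
    (2 : ℝ) ^ wdeg (indWeights (insert e S)) i - 2 ^ wdeg (indWeights (S \ {e})) i ≤
      wdeg (indWeights {e}) i * 2 ^ wdeg (indWeights S) i := by
  classical
  rw [indWeights_insert, wdeg_add, wdeg_indWeights_singleton]
  split_ifs
  · have hmono : (2 : ℝ) ^ wdeg (indWeights (S \ {e})) i ≤ 2 ^ wdeg (indWeights S) i :=
      Real.rpow_le_rpow_of_exponent_le one_le_two
        (wdeg_mono (indWeights_mono Set.sdiff_subset) i)
    rw [Real.rpow_add two_pos, Real.rpow_one]
    linarith
  · simp

lemma bernoulliMean_two_rpow_wdeg_le (E : Finset (Sym2 (Fin n))) (i : Fin n) {p : ℝ} (hp₀ : 0 ≤ p)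
    (hp₁ : p ≤ 1) :
    bernoulliMean E p (fun S => 2 ^ wdeg (indWeights S) i) ≤ Real.exp (n * p) := by
  have hinfluence (S : Set (Sym2 (Fin n))) :
      ∑ e ∈ E, ((2 : ℝ) ^ wdeg (indWeights (insert e S)) i -
        2 ^ wdeg (indWeights (S \ {e})) i) ≤ n * 2 ^ wdeg (indWeights S) i := by
    refine (Finset.sum_le_sum fun e _ => two_rpow_wdeg_insert_sub_sdiff_le S e i).trans ?_
    rw [← Finset.sum_mul]
    exact mul_le_mul_of_nonneg_right (sum_wdeg_indWeights_singleton_le E i)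
      (Real.rpow_nonneg zero_le_two _)
  have h := bernoulliMean_le_exp_mul (φ := fun S => 2 ^ wdeg (indWeights S) i) hinfluence hp₀ hp₁
  rwa [indWeights_empty, show wdeg (0 : Weights n) i = 0 by simp [wdeg], Real.rpow_zero,
    mul_one] at h

lemma binomialRandom_real_objective_lt_le (hn : 2 ≤ n) (p : unitInterval) :
    (SimpleGraph.binomialRandom (Fin n) p).real
      {G | objective (indWeights G.edgeSet) < n * p / 4} ≤ n * Real.exp (-(n * p / 32)) := by
  have hmarkov := mul_meas_ge_le_integral_of_nonneg (μ := SimpleGraph.binomialRandom (Fin n) p)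
    (f := fun G => potential (1 / 8) (indWeights G.edgeSet))
    (ae_of_all _ fun G => (potential_pos hn _ _).le) .of_finite (Real.exp (-(n * p / 32)))
  rw [integral_edgeSet_binomialRandom p fun S => potential (1 / 8) (indWeights S),
    mul_comm, ← le_div_iff₀ (Real.exp_pos _)] at hmarkov
  have hmean := bernoulliMean_potential_le (by omega : n ≠ 0) (s := 1 / 8) (by norm_num)
    p.2.1 p.2.2
  refine (measureReal_mono fun G hG => ?_).trans (hmarkov.trans ?_)
  · have hlog := neg_log_potential_le hn (s := 1 / 8) (by norm_num) (indWeights G.edgeSet)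
    rw [Set.mem_ofPred_eq] at hG ⊢
    rw [← Real.le_log_iff_exp_le (potential_pos hn _ _)]
    linarith
  · rw [div_le_iff₀ (Real.exp_pos _), mul_assoc, ← Real.exp_add, mul_comm]
    refine hmean.trans (mul_le_mul (Real.exp_le_exp.2 (by linarith)) (by linarith) ?_
      (Real.exp_pos _).le)
    rw [sub_nonneg, Nat.one_le_cast]
    omega

lemma binomialRandom_real_lt_wdeg_le (p : unitInterval) (i : Fin n) :
    (SimpleGraph.binomialRandom (Fin n) p).real
      {G | 2 * n * (p : ℝ) < wdeg (indWeights G.edgeSet) i} ≤ Real.exp (-(n * p / 32)) := by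
  have hmarkov := mul_meas_ge_le_integral_of_nonneg (μ := SimpleGraph.binomialRandom (Fin n) p)
    (f := fun G => (2 : ℝ) ^ wdeg (indWeights G.edgeSet) i)
    (ae_of_all _ fun G => Real.rpow_nonneg zero_le_two _) .of_finite (2 ^ (2 * n * (p : ℝ)))
  have hpos : (0 : ℝ) < 2 ^ (2 * n * (p : ℝ)) := Real.rpow_pos_of_pos two_pos _
  rw [integral_edgeSet_binomialRandom p fun S => (2 : ℝ) ^ wdeg (indWeights S) i,
    mul_comm, ← le_div_iff₀ hpos] at hmarkov
  refine (measureReal_mono fun G hG => ?_).trans (hmarkov.trans ?_)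
  · exact Real.rpow_le_rpow_of_exponent_le one_le_two hG.le
  · rw [div_le_iff₀ hpos, Real.rpow_def_of_pos two_pos, ← Real.exp_add]
    refine (bernoulliMean_two_rpow_wdeg_le _ i p.2.1 p.2.2).trans (Real.exp_le_exp.2 ?_)
    nlinarith [Real.log_two_gt_d9, mul_nonneg n.cast_nonneg p.2.1]

/-- The graphs on which the analysis of the algorithm runs: all degrees are at most `2np`, and the
spectral gap of the unweighted Laplacian is at least `np/4`. -/
def IsWellConnected (p : ℝ) (G : SimpleGraph (Fin n)) : Prop :=
  (∀ i, wdeg (indWeights G.edgeSet) i ≤ 2 * n * p) ∧ n * p / 4 ≤ objective (indWeights G.edgeSet)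

lemma binomialRandom_real_not_isWellConnected_le (hn : 2 ≤ n) (p : unitInterval) :
    (SimpleGraph.binomialRandom (Fin n) p).real {G | ¬ IsWellConnected p G} ≤
      2 * n * Real.exp (-(n * p / 32)) := by
  have hsub : {G : SimpleGraph (Fin n) | ¬ IsWellConnected p G} ⊆
      (⋃ i, {G | 2 * n * (p : ℝ) < wdeg (indWeights G.edgeSet) i}) ∪
        {G | objective (indWeights G.edgeSet) < n * p / 4} := by
    intro G hG
    by_contra hcon
    simp only [Set.mem_union, Set.mem_iUnion, Set.mem_ofPred_eq, not_or, not_exists, not_lt] at hcon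
    exact hG hcon
  have hdeg : (SimpleGraph.binomialRandom (Fin n) p).real
      (⋃ i, {G | 2 * n * (p : ℝ) < wdeg (indWeights G.edgeSet) i}) ≤
      n * Real.exp (-(n * p / 32)) := by
    refine (measureReal_iUnion_fintype_le _).trans
      ((Finset.sum_le_sum fun i _ => binomialRandom_real_lt_wdeg_le p i).trans_eq ?_)
    rw [Finset.sum_const, Finset.card_univ, Fintype.card_fin, nsmul_eq_mul]
  calc _ ≤ _ := measureReal_mono hsub
    _ ≤ _ := measureReal_union_le _ _
    _ ≤ n * Real.exp (-(n * p / 32)) + n * Real.exp (-(n * p / 32)) :=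
        add_le_add hdeg (binomialRandom_real_objective_lt_le hn p)
    _ = 2 * n * Real.exp (-(n * p / 32)) := by ring

end RandomGraph

section RandomSigns

open scoped BigOperators

lemma expect_prod_eq_prod_expect {ι Ω : Type*} [Fintype ι] [DecidableEq ι] [Fintype Ω]
    (f : ι → Ω → ℝ) : 𝔼 σ : ι → Ω, ∏ i, f i (σ i) = ∏ i, 𝔼 ω, f i ω := by
  simp only [Fintype.expect_eq_sum_div_card, Finset.prod_div_distrib, Fintype.prod_sum,
    Finset.prod_const, Fintype.card_fun, Finset.card_univ, Nat.cast_pow]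

lemma expect_int_units (f : ℤˣ → ℝ) : 𝔼 b, f b = (f 1 + f (-1)) / 2 := by
  rw [Fintype.expect_eq_sum_div_card, UnitsInt.univ, Finset.sum_pair (by decide),
    Fintype.card_units_int, Nat.cast_ofNat]

lemma lintegral_uniformOn_range {α β : Type*} [Fintype α] [Nonempty α] [MeasurableSpace β]
    [MeasurableSingletonClass β] {f : α → β} (hf : f.Injective) {g : β → ℝ} (hg : ∀ b, 0 ≤ g b) :
    ∫⁻ b, ENNReal.ofReal (g b) ∂uniformOn (Set.range f) = ENNReal.ofReal (𝔼 a, g (f a)) := by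
  classical
  have hrange : Set.range f = (Finset.univ.image f : Finset β) := by simp
  rw [hrange, uniformOn, ProbabilityTheory.cond, lintegral_smul_measure,
    Measure.count_apply_finset, lintegral_finset, Finset.card_image_of_injective _ hf]
  simp only [Measure.count_singleton, mul_one, smul_eq_mul]
  rw [Finset.sum_image fun _ _ _ _ h => hf h, ← ENNReal.ofReal_sum_of_nonneg fun a _ => hg (f a),
    Fintype.expect_eq_sum_div_card,
    ENNReal.ofReal_div_of_pos (Nat.cast_pos.2 Fintype.card_pos), ENNReal.ofReal_natCast,
    Finset.card_univ, ENNReal.div_eq_inv_mul]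

variable {ι : Type*} [Fintype ι]

/-- The Rademacher sum `∑ σ_i x_i` with coefficients `x` and signs `σ`. -/
def radSum (x : ι → ℝ) (σ : ι → ℤˣ) : ℝ := ∑ i, ((σ i : ℤ) : ℝ) * x i

lemma radSum_div (x : ι → ℝ) (c : ℝ) (σ : ι → ℤˣ) :
    radSum (fun i => x i / c) σ = radSum x σ / c := by
  simp only [radSum, Finset.sum_div, mul_div_assoc]

variable [DecidableEq ι] {x : ι → ℝ}

lemma expect_exp_mul_radSum_le (hx : ∑ i, x i ^ 2 = 1) (t : ℝ) :
    𝔼 σ, Real.exp (t * radSum x σ) ≤ Real.exp (t ^ 2 / 2) := by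
  calc 𝔼 σ, Real.exp (t * radSum x σ)
      = ∏ i, 𝔼 b : ℤˣ, Real.exp (t * (((b : ℤ) : ℝ) * x i)) := by
        rw [← expect_prod_eq_prod_expect fun i (b : ℤˣ) => Real.exp (t * (((b : ℤ) : ℝ) * x i))]
        simp only [radSum, Finset.mul_sum, Real.exp_sum]
    _ = ∏ i, Real.cosh (t * x i) := by
        simp only [expect_int_units, Real.cosh_eq, Units.val_one, Units.val_neg, Int.cast_one,
          Int.cast_neg, one_mul, neg_one_mul, mul_neg]
    _ ≤ ∏ i, Real.exp ((t * x i) ^ 2 / 2) :=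
        Finset.prod_le_prod (fun i _ => (Real.cosh_pos _).le) fun i _ =>
          Real.cosh_le_exp_half_sq _
    _ = Real.exp (t ^ 2 / 2) := by
        simp only [← Real.exp_sum, mul_pow, ← Finset.sum_div, ← Finset.mul_sum, hx, mul_one]

lemma neg_sq_add_mul_eq (g y : ℝ) : -g ^ 2 + g * y = y ^ 2 / 4 + -1 * (g - y / 2) ^ 2 := by ring

lemma integrable_exp_neg_sq_add (y : ℝ) :
    Integrable fun g : ℝ => Real.exp (-g ^ 2 + g * y) := by
  simp only [neg_sq_add_mul_eq, Real.exp_add]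
  exact ((integrable_exp_neg_mul_sq one_pos).comp_sub_right (y / 2)).const_mul _

lemma integral_exp_neg_sq_add (y : ℝ) :
    ∫ g : ℝ, Real.exp (-g ^ 2 + g * y) = Real.exp (y ^ 2 / 4) * √Real.pi := by
  simp only [neg_sq_add_mul_eq, Real.exp_add]
  rw [integral_const_mul, integral_sub_right_eq_self (fun g => Real.exp (-1 * g ^ 2)) (y / 2),
    integral_gaussian, div_one]

-- Gaussian linearization: `exp (y² / 4)` is a mixture of the functions `exp (g y)`, whose
-- expectations were bounded above.
lemma expect_exp_sq_radSum_div_four_le (hx : ∑ i, x i ^ 2 = 1) :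
    𝔼 σ, Real.exp (radSum x σ ^ 2 / 4) ≤ √2 := by
  refine le_of_mul_le_mul_right ?_ (Real.sqrt_pos.2 Real.pi_pos)
  have hintg (σ : ι → ℤˣ) := integrable_exp_neg_sq_add (radSum x σ)
  calc (𝔼 σ, Real.exp (radSum x σ ^ 2 / 4)) * √Real.pi
      = ∫ g : ℝ, 𝔼 σ, Real.exp (-g ^ 2 + g * radSum x σ) := by
        simp only [Fintype.expect_eq_sum_div_card]
        rw [integral_div, integral_finsetSum _ fun σ _ => hintg σ]
        simp only [integral_exp_neg_sq_add, ← Finset.sum_mul]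
        ring
    _ ≤ ∫ g : ℝ, Real.exp (-(1 / 2) * g ^ 2) := by
        refine integral_mono ?_ (integrable_exp_neg_mul_sq (by norm_num)) fun g => ?_
        · simp only [Fintype.expect_eq_sum_div_card]
          exact (integrable_finsetSum _ fun σ _ => hintg σ).div_const _
        · simp only [Real.exp_add, ← Finset.mul_expect]
          refine (mul_le_mul_of_nonneg_left (expect_exp_mul_radSum_le hx g)
            (Real.exp_pos _).le).trans_eq ?_
          rw [← Real.exp_add]
          ring_nf
    _ = √2 * √Real.pi := by
        rw [integral_gaussian, ← Real.sqrt_mul zero_le_two]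
        ring_nf

lemma expect_sign_mul_sign (i j : ι) :
    𝔼 σ : ι → ℤˣ, ((σ i : ℤ) : ℝ) * ((σ j : ℤ) : ℝ) = if i = j then 1 else 0 := by
  split_ifs with h
  · subst h
    simp [← Int.cast_mul, ← Units.val_mul, Int.units_mul_self]
  · have hprod (σ : ι → ℤˣ) : ((σ i : ℤ) : ℝ) * ((σ j : ℤ) : ℝ) =
        ∏ l, (if l = i then ((σ l : ℤ) : ℝ) else 1) * (if l = j then ((σ l : ℤ) : ℝ) else 1) := by
      rw [Finset.prod_mul_distrib]
      simp
    simp only [hprod]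
    rw [expect_prod_eq_prod_expect fun l (b : ℤˣ) =>
      (if l = i then ((b : ℤ) : ℝ) else 1) * (if l = j then ((b : ℤ) : ℝ) else 1)]
    exact Finset.prod_eq_zero (Finset.mem_univ i) (by rw [expect_int_units]; simp [h])

lemma expect_radSum_sq (x : ι → ℝ) : 𝔼 σ, radSum x σ ^ 2 = ∑ i, x i ^ 2 := by
  have hsq (σ : ι → ℤˣ) : radSum x σ ^ 2 =
      ∑ i, ∑ j, x i * x j * (((σ i : ℤ) : ℝ) * ((σ j : ℤ) : ℝ)) := by
    rw [radSum, sq, Finset.sum_mul_sum]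
    exact Finset.sum_congr rfl fun i _ => Finset.sum_congr rfl fun j _ => by ring
  simp only [hsq, Finset.expect_sum_comm, ← Finset.mul_expect, expect_sign_mul_sign, mul_ite,
    mul_one, mul_zero, Finset.sum_ite_eq, Finset.mem_univ, if_true, sq]

lemma exp_le_one_add_add_sq_mul (u : ℝ) :
    Real.exp u ≤ 1 + u + u ^ 2 * Real.exp |u| := by
  have hsq := le_mul_of_one_le_right (sq_nonneg u) (Real.one_le_exp (abs_nonneg u))
  rcases le_or_gt |u| 1 with h | h
  · linarith [(abs_le.1 (Real.abs_exp_sub_one_sub_id_le h)).2]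
  · have hu2 : 1 ≤ u ^ 2 := one_le_sq_iff_one_le_abs u |>.2 h.le
    rcases le_total 0 u with hu | hu
    · rw [abs_of_nonneg hu] at h ⊢
      linarith [le_mul_of_one_le_left (Real.exp_pos u).le hu2]
    · rw [abs_of_nonpos hu] at h hsq ⊢
      nlinarith [Real.exp_le_one_iff.2 hu]

lemma exp_mul_sub_one_le {r y : ℝ} (hr : |r| ≤ 1 / 8) (hy : 0 ≤ y) :
    Real.exp (r * (y - 1)) ≤
      1 + r * (y - 1) + 128 * r ^ 2 * (Real.exp (1 / 4) * Real.exp (y / 4)) := by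
  refine (exp_le_one_add_add_sq_mul _).trans (add_le_add_right ?_ _)
  have habs : |r * (y - 1)| ≤ (y + 1) / 8 := by
    rw [abs_mul]
    calc |r| * |y - 1| ≤ 1 / 8 * (y + 1) := by
          gcongr
          exact abs_le.2 ⟨by linarith, by linarith⟩
      _ = (y + 1) / 8 := by ring
  have hsq : (y - 1) ^ 2 ≤ 128 * Real.exp ((y + 1) / 8) := by
    nlinarith [Real.quadratic_le_exp_of_nonneg (show 0 ≤ (y + 1) / 8 by positivity)]
  calc (r * (y - 1)) ^ 2 * Real.exp |r * (y - 1)|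
      ≤ r ^ 2 * (128 * Real.exp ((y + 1) / 8)) * Real.exp ((y + 1) / 8) := by
        rw [mul_pow]
        gcongr
    _ = 128 * r ^ 2 * (Real.exp ((y + 1) / 8) * Real.exp ((y + 1) / 8)) := by ring
    _ = 128 * r ^ 2 * (Real.exp (1 / 4) * Real.exp (y / 4)) := by
        rw [← Real.exp_add, ← Real.exp_add]
        ring_nf

lemma exp_quarter_mul_sqrt_two_le : Real.exp (1 / 4) * √2 ≤ 2 := by
  have hexp : Real.exp (1 / 4) ≤ 4 / 3 :=
    (Real.exp_bound_div_one_sub_of_interval (by norm_num) (by norm_num)).trans_eq (by norm_num)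
  have hsqrt : √2 ≤ 3 / 2 := Real.sqrt_le_iff.2 ⟨by norm_num, by norm_num⟩
  calc Real.exp (1 / 4) * √2 ≤ 4 / 3 * (3 / 2) := by gcongr
    _ = 2 := by norm_num

lemma expect_exp_mul_sq_radSum_sub_one_le (hx : ∑ i, x i ^ 2 = 1) {r : ℝ} (hr : |r| ≤ 1 / 8) :
    𝔼 σ, Real.exp (r * (radSum x σ ^ 2 - 1)) ≤ Real.exp (256 * r ^ 2) := by
  calc 𝔼 σ, Real.exp (r * (radSum x σ ^ 2 - 1))
      ≤ 𝔼 σ, (1 + r * (radSum x σ ^ 2 - 1) +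
          128 * r ^ 2 * (Real.exp (1 / 4) * Real.exp (radSum x σ ^ 2 / 4))) :=
        Finset.expect_le_expect fun σ _ => exp_mul_sub_one_le hr (sq_nonneg _)
    _ = 1 + 128 * r ^ 2 * (Real.exp (1 / 4) * 𝔼 σ, Real.exp (radSum x σ ^ 2 / 4)) := by
        simp only [Finset.expect_add_distrib, ← Finset.mul_expect, Finset.expect_sub_distrib,
          Fintype.expect_const, expect_radSum_sq, hx, sub_self, mul_zero, add_zero]
    _ ≤ 1 + 128 * r ^ 2 * 2 := by
        gcongr
        refine le_trans ?_ exp_quarter_mul_sqrt_two_le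
        gcongr
        exact expect_exp_sq_radSum_div_four_le hx
    _ ≤ Real.exp (256 * r ^ 2) := by linarith [Real.add_one_le_exp (256 * r ^ 2)]

end RandomSigns

section SignSketch

open scoped BigOperators

variable {ι : Type*} {k : ℕ}

/-- The `ι × k` matrix with entries `±1 / √k` whose columns have the signs `σ l`. -/
noncomputable def signMatrix (σ : Fin k → ι → ℤˣ) : ι → Fin k → ℝ :=
  fun i l => ((σ l i : ℤ) : ℝ) * (1 / √(k : ℝ))

lemma signMatrix_injective : (signMatrix : (Fin k → ι → ℤˣ) → ι → Fin k → ℝ).Injective := by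
  intro σ τ h
  ext l i
  have hk : 0 < √(k : ℝ) := Real.sqrt_pos.2 (Nat.cast_pos.2 l.pos)
  exact_mod_cast mul_right_cancel₀ (one_div_pos.2 hk).ne' (congrFun₂ h i l)

lemma range_signMatrix (n k : ℕ) :
    Set.range (signMatrix : (Fin k → Fin n → ℤˣ) → _) = signMatrices n k := by
  ext R
  constructor
  · rintro ⟨σ, rfl⟩ i l
    rcases Int.units_eq_one_or (σ l i) with h | h <;> simp [signMatrix, h]
  · intro hR
    classical
    refine ⟨fun l i => if R i l = 1 / √(k : ℝ) then 1 else -1, ?_⟩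
    ext i l
    rcases eq_or_ne (R i l) (1 / √(k : ℝ)) with h | h
    · simp [signMatrix, h]
    · rw [signMatrix, if_neg h, (hR i l).resolve_left h]
      simp

variable [Fintype ι]

/-- The relative error of `‖Rᵀ y‖²` as an estimate of `‖y‖²`; it is only meaningful for `y ≠ 0`. -/
noncomputable def relError (y : ι → ℝ) (R : ι → Fin k → ℝ) : ℝ :=
  (∑ l, (∑ i, R i l * y i) ^ 2) / (∑ i, y i ^ 2) - 1

lemma sum_signMatrix_mul_sq (y : ι → ℝ) (σ : Fin k → ι → ℤˣ) (l : Fin k) :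
    (∑ i, signMatrix σ i l * y i) ^ 2 = radSum y (σ l) ^ 2 / k := by
  have h : ∑ i, signMatrix σ i l * y i = radSum y (σ l) / √(k : ℝ) := by
    rw [radSum, Finset.sum_div]
    exact Finset.sum_congr rfl fun i _ => by rw [signMatrix]; ring
  rw [h, div_pow, Real.sq_sqrt (Nat.cast_nonneg k)]

lemma mul_relError_signMatrix (hk : k ≠ 0) {y : ι → ℝ} (σ : Fin k → ι → ℤˣ) :
    k * relError y (signMatrix σ) =
      ∑ l, (radSum (fun i => y i / √(∑ i, y i ^ 2)) (σ l) ^ 2 - 1) := by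
  have hk' : (k : ℝ) ≠ 0 := Nat.cast_ne_zero.2 hk
  simp only [relError, sum_signMatrix_mul_sq, radSum_div, div_pow,
    Real.sq_sqrt (Finset.sum_nonneg fun i _ => sq_nonneg (y i)), ← Finset.sum_div,
    Finset.sum_sub_distrib, Finset.sum_const, Finset.card_univ, Fintype.card_fin, nsmul_eq_mul,
    mul_one]
  rw [div_right_comm, mul_sub, mul_one, mul_div_cancel₀ _ hk']

lemma sum_sq_div_sqrt_sum_sq {y : ι → ℝ} (hy : ∑ i, y i ^ 2 ≠ 0) :
    ∑ i, (y i / √(∑ i, y i ^ 2)) ^ 2 = 1 := by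
  simp only [div_pow, ← Finset.sum_div]
  rw [Real.sq_sqrt (Finset.sum_nonneg fun i _ => sq_nonneg _), div_self hy]

lemma max_zero_abs_sub_le_exp {c ε z : ℝ} (hc : 0 < c) :
    max 0 (|z| - ε) ≤ c⁻¹ * Real.exp (-(c * ε)) * (Real.exp (c * z) + Real.exp (-c * z)) := by
  have habs : Real.exp (c * |z|) ≤ Real.exp (c * z) + Real.exp (-c * z) := by
    rcases abs_choice z with h | h <;> rw [h]
    · exact le_add_of_nonneg_right (Real.exp_pos _).le
    · rw [mul_neg, neg_mul]
      exact le_add_of_nonneg_left (Real.exp_pos _).le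
  calc max 0 (|z| - ε) ≤ c⁻¹ * Real.exp (c * (|z| - ε)) := by
        refine max_le (by positivity) ?_
        rw [← div_eq_inv_mul, le_div_iff₀ hc]
        linarith [Real.add_one_le_exp (c * (|z| - ε))]
    _ = c⁻¹ * Real.exp (-(c * ε)) * Real.exp (c * |z|) := by
        rw [mul_assoc, ← Real.exp_add]
        ring_nf
    _ ≤ _ := by gcongr

variable [DecidableEq ι]

lemma expect_exp_mul_relError_le (hk : k ≠ 0) {y : ι → ℝ} (hy : ∑ i, y i ^ 2 ≠ 0) {r : ℝ}
    (hr : |r| ≤ 1 / 8) :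
    𝔼 σ : Fin k → ι → ℤˣ, Real.exp (r * k * relError y (signMatrix σ)) ≤
      Real.exp (256 * r ^ 2 * k) := by
  simp only [mul_assoc r, mul_relError_signMatrix hk, Finset.mul_sum, Real.exp_sum]
  rw [expect_prod_eq_prod_expect fun (_ : Fin k) τ =>
      Real.exp (r * (radSum (fun i => y i / √(∑ i, y i ^ 2)) τ ^ 2 - 1)),
    Finset.prod_const, Finset.card_univ, Fintype.card_fin, mul_comm (256 * r ^ 2), Real.exp_nat_mul]
  exact pow_le_pow_left₀ (Finset.expect_nonneg fun _ _ => (Real.exp_pos _).le)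
    (expect_exp_mul_sq_radSum_sub_one_le (sum_sq_div_sqrt_sum_sq hy) hr) k

lemma expect_relError_excess_le (hk : k ≠ 0) {y : ι → ℝ} (hy : ∑ i, y i ^ 2 ≠ 0) {ε : ℝ}
    (hε : 0 < ε) (hε1 : ε ≤ 1) :
    𝔼 σ : Fin k → ι → ℤˣ, max 0 (|relError y (signMatrix σ)| - ε) ≤
      1024 / (ε * k) * Real.exp (-(ε ^ 2 * k / 1024)) := by
  have : (0 : ℝ) < k := Nat.cast_pos.2 (Nat.pos_of_ne_zero hk)
  have hr : |ε / 512| ≤ 1 / 8 := by rw [abs_of_pos (by positivity)]; linarith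
  have hpos := expect_exp_mul_relError_le hk hy hr
  have hneg := expect_exp_mul_relError_le hk hy (r := -(ε / 512)) (by rwa [abs_neg])
  rw [neg_sq] at hneg
  calc 𝔼 σ : Fin k → ι → ℤˣ, max 0 (|relError y (signMatrix σ)| - ε)
      ≤ (ε / 512 * k)⁻¹ * Real.exp (-(ε / 512 * k * ε)) *
          (𝔼 σ : Fin k → ι → ℤˣ, Real.exp (ε / 512 * k * relError y (signMatrix σ)) +
            𝔼 σ : Fin k → ι → ℤˣ, Real.exp (-(ε / 512) * k * relError y (signMatrix σ))) := by
        rw [← Finset.expect_add_distrib, Finset.mul_expect]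
        refine Finset.expect_le_expect fun σ _ =>
          (max_zero_abs_sub_le_exp (c := ε / 512 * k) (by positivity)).trans_eq ?_
        simp only [neg_mul]
    _ ≤ (ε / 512 * k)⁻¹ * Real.exp (-(ε / 512 * k * ε)) *
          (Real.exp (256 * (ε / 512) ^ 2 * k) + Real.exp (256 * (ε / 512) ^ 2 * k)) := by gcongr
    _ = 1024 / (ε * k) *
          (Real.exp (-(ε / 512 * k * ε)) * Real.exp (256 * (ε / 512) ^ 2 * k)) := by
        field_simp
        ring
    _ = _ := by
        rw [← Real.exp_add]
        ring_nf

end SignSketch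

section Greedy

variable {n : ℕ}

lemma residual_le {b : ℝ} {w : Weights n} {e : Sym2 (Fin n)} {i : Fin n} (hi : i ∈ e) :
    residual b w e ≤ b - wdeg w i := by
  obtain ⟨j, rfl⟩ := hi
  exact min_le_left _ _

lemma exists_residual_eq (b : ℝ) (w : Weights n) (e : Sym2 (Fin n)) :
    ∃ i ∈ e, residual b w e = b - wdeg w i := by
  induction e with | _ i j => ?_
  rcases min_choice (b - wdeg w i) (b - wdeg w j) with h | h
  · exact ⟨i, Sym2.mem_mk_left i j, h⟩
  · exact ⟨j, Sym2.mem_mk_right i j, h⟩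

lemma wdeg_smul (r : ℝ) (w : Weights n) (i : Fin n) : wdeg (r • w) i = r * wdeg w i := by
  simp [wdeg, Finset.mul_sum]

lemma greedyStep_self (b : ℝ) (w : Weights n) (e : Sym2 (Fin n)) :
    greedyStep b w e e = min 1 (residual b w e) :=
  Function.update_self ..

lemma greedyStep_of_ne (b : ℝ) (w : Weights n) {e f : Sym2 (Fin n)} (h : f ≠ e) :
    greedyStep b w e f = w f :=
  Function.update_of_ne h ..

lemma wdeg_greedyStep (b : ℝ) {w : Weights n} {e : Sym2 (Fin n)} (he : w e = 0) (i : Fin n)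
    [Decidable (i ∈ e)] :
    wdeg (greedyStep b w e) i = wdeg w i + if i ∈ e then min 1 (residual b w e) else 0 := by
  have hstep : greedyStep b w e = w + min 1 (residual b w e) • indWeights {e} := by
    ext f
    rcases eq_or_ne f e with rfl | hf
    · simp [greedyStep_self, indWeights, he]
    · simp [greedyStep_of_ne b w hf, indWeights, hf]
  rw [hstep, wdeg_add, wdeg_smul, wdeg_indWeights_singleton, mul_ite, mul_one, mul_zero]

/-- What the greedy procedure guarantees after it has processed the edges in `l`: every processed
edge is either used fully or has a saturated endpoint all of whose used edges have at least the
same gain. -/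
structure GreedyInvariant (b : ℝ) (c : Weights n) (l : List (Sym2 (Fin n))) (w : Weights n) :
    Prop where
  nonneg : ∀ e, 0 ≤ w e
  le_one : ∀ e, w e ≤ 1
  eq_zero : ∀ e ∉ l, w e = 0
  wdeg_le : ∀ i, wdeg w i ≤ b
  full_or_saturated : ∀ e ∈ l, w e = 1 ∨
    ∃ i ∈ e, wdeg w i = b ∧ ∀ f, i ∈ f → 0 < w f → c e ≤ c f

namespace GreedyInvariant

variable {b : ℝ} {c w : Weights n} {l : List (Sym2 (Fin n))} {e : Sym2 (Fin n)}

lemma nil (hb : 0 ≤ b) (c : Weights n) : GreedyInvariant b c [] 0 where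
  nonneg _ := le_rfl
  le_one _ := zero_le_one
  eq_zero _ _ := rfl
  wdeg_le i := by simpa [wdeg] using hb
  full_or_saturated _ he := absurd he List.not_mem_nil

lemma residual_nonneg (h : GreedyInvariant b c l w) (e : Sym2 (Fin n)) : 0 ≤ residual b w e := by
  obtain ⟨i, -, hi⟩ := exists_residual_eq b w e
  exact hi ▸ sub_nonneg.2 (h.wdeg_le i)

lemma le_wdeg_greedyStep (h : GreedyInvariant b c l w) (he : e ∉ l) (i : Fin n) :
    wdeg w i ≤ wdeg (greedyStep b w e) i := by
  classical
  rw [wdeg_greedyStep b (h.eq_zero e he)]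
  split_ifs
  · exact le_add_of_nonneg_right (le_min zero_le_one (h.residual_nonneg e))
  · rw [add_zero]

lemma wdeg_greedyStep_le (h : GreedyInvariant b c l w) (he : e ∉ l) (i : Fin n) :
    wdeg (greedyStep b w e) i ≤ b := by
  classical
  rw [wdeg_greedyStep b (h.eq_zero e he)]
  split_ifs with hi
  · linarith [min_le_right 1 (residual b w e), residual_le (b := b) (w := w) hi]
  · linarith [h.wdeg_le i]

lemma greedyStep_self_full_or_saturated (h : GreedyInvariant b c l w) (he : e ∉ l)
    (hce : ∀ f ∈ l, c e ≤ c f) : greedyStep b w e e = 1 ∨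
      ∃ i ∈ e, wdeg (greedyStep b w e) i = b ∧
        ∀ f, i ∈ f → 0 < greedyStep b w e f → c e ≤ c f := by
  classical
  rw [greedyStep_self]
  rcases min_choice 1 (residual b w e) with hmin | hmin
  · exact Or.inl hmin
  obtain ⟨i, hi, hres⟩ := exists_residual_eq b w e
  refine Or.inr ⟨i, hi, ?_, fun f _ hf => ?_⟩
  · rw [wdeg_greedyStep b (h.eq_zero e he), if_pos hi, hmin, hres, add_sub_cancel]
  · rcases eq_or_ne f e with rfl | hfe
    · rfl
    · rw [greedyStep_of_ne b w hfe] at hf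
      exact hce f (by_contra fun hfl => hf.ne' (h.eq_zero f hfl))

lemma greedyStep_of_mem_full_or_saturated (h : GreedyInvariant b c l w) (he : e ∉ l)
    {f : Sym2 (Fin n)} (hf : f ∈ l) : greedyStep b w e f = 1 ∨
      ∃ i ∈ f, wdeg (greedyStep b w e) i = b ∧
        ∀ g, i ∈ g → 0 < greedyStep b w e g → c f ≤ c g := by
  rw [greedyStep_of_ne b w (ne_of_mem_of_not_mem hf he)]
  refine (h.full_or_saturated f hf).imp_right fun ⟨i, hi, hib, hle⟩ =>
    ⟨i, hi, (h.wdeg_greedyStep_le he i).antisymm (hib ▸ h.le_wdeg_greedyStep he i),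
      fun g hg hg0 => ?_⟩
  rcases eq_or_ne g e with rfl | hge
  · rw [greedyStep_self] at hg0
    linarith [min_le_right 1 (residual b w g), residual_le (b := b) (w := w) hg]
  · exact hle g hg (by rwa [greedyStep_of_ne b w hge] at hg0)

lemma append_singleton (h : GreedyInvariant b c l w) (he : e ∉ l) (hce : ∀ f ∈ l, c e ≤ c f) :
    GreedyInvariant b c (l ++ [e]) (greedyStep b w e) where
  nonneg f := by
    rcases eq_or_ne f e with rfl | hf
    · exact (greedyStep_self b w f).symm ▸ le_min zero_le_one (h.residual_nonneg f)
    · exact (greedyStep_of_ne b w hf).symm ▸ h.nonneg f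
  le_one f := by
    rcases eq_or_ne f e with rfl | hf
    · exact (greedyStep_self b w f).symm ▸ min_le_left _ _
    · exact (greedyStep_of_ne b w hf).symm ▸ h.le_one f
  eq_zero f hf := by
    rw [List.mem_append, List.mem_singleton, not_or] at hf
    rw [greedyStep_of_ne b w hf.2, h.eq_zero f hf.1]
  wdeg_le := h.wdeg_greedyStep_le he
  full_or_saturated f hf := by
    rcases List.mem_append.1 hf with hf | hf
    · exact h.greedyStep_of_mem_full_or_saturated he hf
    · rw [List.mem_singleton.1 hf]
      exact h.greedyStep_self_full_or_saturated he hce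

lemma foldl (hb : 0 ≤ b) (c : Weights n) (l : List (Sym2 (Fin n))) (hnodup : l.Nodup)
    (hsorted : l.Pairwise fun e e' => c e' ≤ c e) :
    GreedyInvariant b c l (l.foldl (greedyStep b) 0) := by
  induction l using List.reverseRecOn with
  | nil => exact nil hb c
  | append_singleton l e ih =>
    rw [List.nodup_append] at hnodup
    rw [List.pairwise_append] at hsorted
    rw [List.foldl_append, List.foldl_cons, List.foldl_nil]
    have he := List.mem_singleton_self e
    exact (ih hnodup.1 hsorted.1).append_singleton (fun h => hnodup.2.2 e h e he rfl)
      fun f hf => hsorted.2.2 f hf e he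

end GreedyInvariant

/-- The sum of a vertex potential over the two endpoints of an edge. -/
def endpointSum (y : Fin n → ℝ) (e : Sym2 (Fin n)) : ℝ :=
  Sym2.lift ⟨fun i j => y i + y j, fun _ _ => add_comm _ _⟩ e

lemma sum_endpointSum_mul (y : Fin n → ℝ) {w : Weights n} (hw : ∀ i, w s(i, i) = 0) :
    ∑ e, endpointSum y e * w e = ∑ i, y i * wdeg w i := by
  have h := sum_sum_sym2_mk (f := fun e => endpointSum y e * w e) (by simp [hw])
  have hleft : ∑ i, ∑ j, y i * w s(i, j) = ∑ i, y i * wdeg w i := by simp [wdeg, Finset.mul_sum]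
  have hright : ∑ i, ∑ j, y j * w s(i, j) = ∑ i, y i * wdeg w i := by
    rw [Finset.sum_comm, ← hleft]
    simp only [Sym2.eq_swap]
  simp only [endpointSum, Sym2.lift_mk, add_mul, Finset.sum_add_distrib, hleft, hright,
    nsmul_eq_mul, Nat.cast_ofNat] at h ⊢
  linarith

lemma le_endpointSum {y : Fin n → ℝ} (hy : ∀ i, 0 ≤ y i) {i : Fin n} {e : Sym2 (Fin n)}
    (hi : i ∈ e) : y i ≤ endpointSum y e := by
  obtain ⟨j, rfl⟩ := hi
  exact le_add_of_nonneg_right (hy j)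

lemma endpointSum_le {y : Fin n → ℝ} {e : Sym2 (Fin n)} {a : ℝ} (h : ∀ i ∈ e, y i ≤ a) :
    endpointSum y e ≤ 2 * a := by
  induction e with | _ i j => ?_
  rw [two_mul]
  exact add_le_add (h i (Sym2.mem_mk_left i j)) (h j (Sym2.mem_mk_right i j))

/-- Weak linear programming duality. -/
lemma sum_mul_le_of_dual_feasible {p : ℝ} {G : SimpleGraph (Fin n)} {c v z : Weights n}
    {y : Fin n → ℝ} (hv : v ∈ feasible G p) (hy : ∀ i, 0 ≤ y i) (hz : ∀ e, 0 ≤ z e)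
    (hc : ∀ e ∈ G.edgeSet, c e ≤ endpointSum y e + z e) :
    ∑ e, c e * v e ≤ ∑ i, y i * (2 * n * p) + ∑ e, z e := by
  obtain ⟨hv0, hvG, hvdeg, hv1⟩ := hv
  have hedge (e : Sym2 (Fin n)) : c e * v e ≤ endpointSum y e * v e + z e := by
    by_cases he : e ∈ G.edgeSet
    · calc c e * v e ≤ endpointSum y e * v e + z e * v e := by
            rw [← add_mul]
            exact mul_le_mul_of_nonneg_right (hc e he) (hv0 e)
        _ ≤ endpointSum y e * v e + z e := by
            gcongr
            exact mul_le_of_le_one_right (hz e) (hv1 e he)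
    · simpa [hvG e he] using hz e
  calc ∑ e, c e * v e ≤ ∑ e, endpointSum y e * v e + ∑ e, z e := by
        rw [← Finset.sum_add_distrib]
        exact Finset.sum_le_sum fun e _ => hedge e
    _ = ∑ i, y i * wdeg v i + ∑ e, z e := by
        rw [sum_endpointSum_mul y fun i => hvG _ (by simp)]
    _ ≤ ∑ i, y i * (2 * n * p) + ∑ e, z e := by
        gcongr with i
        · exact hy i
        · exact hvdeg i

lemma exists_pos_of_wdeg_pos {w : Weights n} {i : Fin n} (h : 0 < wdeg w i) :
    ∃ e, i ∈ e ∧ 0 < w e := by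
  obtain ⟨j, -, hj⟩ := Finset.exists_lt_of_sum_lt (s := Finset.univ) (f := fun _ => 0)
    (g := fun j => w s(i, j)) (by simpa [wdeg] using h)
  exact ⟨s(i, j), Sym2.mem_mk_left i j, hj⟩

/-- The price of a saturated vertex is the least gain of a used edge at it; other vertices are
free. -/
lemma GreedyInvariant.exists_prices {b : ℝ} {c w : Weights n} {l : List (Sym2 (Fin n))}
    (h : GreedyInvariant b c l w) (hb : 0 < b) (hc : ∀ e, 0 ≤ c e) :
    ∃ y : Fin n → ℝ, (∀ i, 0 ≤ y i) ∧ (∀ i, y i * wdeg w i = y i * b) ∧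
      (∀ e, 0 < w e → endpointSum y e ≤ 2 * c e) ∧
      ∀ e ∈ l, w e = 1 ∨ c e ≤ endpointSum y e := by
  classical
  have hprice (i : Fin n) : ∃ y, 0 ≤ y ∧ y * wdeg w i = y * b ∧
      (∀ f, i ∈ f → 0 < w f → y ≤ c f) ∧
      (wdeg w i = b → ∀ t, (∀ f, i ∈ f → 0 < w f → t ≤ c f) → t ≤ y) := by
    by_cases hi : wdeg w i = b
    · obtain ⟨e, he, he0⟩ := exists_pos_of_wdeg_pos (hi ▸ hb)
      obtain ⟨f, hf, hmin⟩ := (Finset.univ.filter fun f => i ∈ f ∧ 0 < w f).exists_min_image c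
        ⟨e, by simp [he, he0]⟩
      simp only [Finset.mem_filter, Finset.mem_univ, true_and, and_imp] at hf hmin
      exact ⟨c f, hc f, by rw [hi], hmin, fun _ t ht => ht f hf.1 hf.2⟩
    · exact ⟨0, le_rfl, by simp, fun f _ _ => hc f, fun h => absurd h hi⟩
  choose y hy0 hyb hyc hymax using hprice
  refine ⟨y, hy0, hyb, fun e he => endpointSum_le fun i hi => hyc i e hi he, fun e he => ?_⟩
  exact (h.full_or_saturated e he).imp_right fun ⟨i, hi, hib, hle⟩ =>
    (hymax i hib (c e) hle).trans (le_endpointSum hy0 hi)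

lemma IsGreedySolution.isApproxSolution {p : ℝ} {G : SimpleGraph (Fin n)} {c w : Weights n}
    (hb : 0 < 2 * (n : ℝ) * p) (hc : ∀ e, 0 ≤ c e) (h : IsGreedySolution p G c w) :
    IsApproxSolution (1 / 2) p G c w := by
  obtain ⟨l, hnodup, hl, hsorted, rfl⟩ := h
  have hinv := GreedyInvariant.foldl hb.le c l hnodup hsorted
  set w := l.foldl (greedyStep (2 * n * p)) 0
  have hwG (e) (he : e ∉ G.edgeSet) : w e = 0 := hinv.eq_zero e (mt (hl e).1 he)
  refine ⟨⟨hinv.nonneg, hwG, hinv.wdeg_le, fun e _ => hinv.le_one e⟩, fun v hv => ?_⟩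
  obtain ⟨y, hy0, hyb, hyused, hycover⟩ := hinv.exists_prices hb hc
  have hz0 (e) : 0 ≤ max 0 (c e - endpointSum y e) * w e :=
    mul_nonneg (le_max_left _ _) (hinv.nonneg e)
  have hdual (e) (he : e ∈ G.edgeSet) :
      c e ≤ endpointSum y e + max 0 (c e - endpointSum y e) * w e := by
    rcases hycover e ((hl e).2 he) with h | h
    · rw [h, mul_one]
      linarith [le_max_right 0 (c e - endpointSum y e)]
    · exact h.trans (le_add_of_nonneg_right (hz0 e))
  have hused (e) : endpointSum y e * w e + max 0 (c e - endpointSum y e) * w e ≤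
      2 * (c e * w e) := by
    rcases (hinv.nonneg e).eq_or_lt with h | h
    · simp [← h]
    · rw [← add_mul, ← mul_assoc, ← max_add_add_left]
      exact mul_le_mul_of_nonneg_right
        (max_le (by linarith [hyused e h]) (by linarith [hc e])) h.le
  have hprimal : ∑ i, y i * (2 * n * p) = ∑ e, endpointSum y e * w e := by
    simp only [sum_endpointSum_mul y fun i => hwG _ (by simp), hyb]
  have hweak := sum_mul_le_of_dual_feasible hv hy0 hz0 hdual
  have hsum := Finset.sum_le_sum fun e (_ : e ∈ Finset.univ) => hused e
  rw [Finset.sum_add_distrib, ← Finset.mul_sum] at hsum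
  linarith

lemma gains_nonneg {k : ℕ} (p ε : ℝ) (w : Weights n) (R : Fin n → Fin k → ℝ) (e : Sym2 (Fin n)) :
    0 ≤ gains p ε w R e :=
  matInner_nonneg (edgeLap_posSemidef e)
    (Matrix.posSemidef_self_mul_conjTranspose (normSketch p ε w R))

end Greedy

section Sketch

open Matrix

variable {n k : ℕ}

/-- The vector `exp(-s L_w) (e_i - e_j)`, whose squared norm is `⟨L_ij, exp(-2s L_w)⟩`. -/
noncomputable def edgeVec (s : ℝ) (w : Weights n) (i j : Fin n) : Fin n → ℝ :=
  NormedSpace.exp (-s • lap w) *ᵥ (Pi.single i 1 - Pi.single j 1)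

/-- The total amount by which the relative errors of the sketched edge gains exceed `ε`. -/
noncomputable def excess (s ε : ℝ) (w : Weights n) (R : Fin n → Fin k → ℝ) : ℝ :=
  ∑ x ∈ (Finset.univ : Finset (Fin n)).offDiag,
    max 0 (|relError (edgeVec s w x.1 x.2) R| - ε)

lemma excess_nonneg (s ε : ℝ) (w : Weights n) (R : Fin n → Fin k → ℝ) : 0 ≤ excess s ε w R :=
  Finset.sum_nonneg fun _ _ => le_max_left _ _

lemma transpose_exp_smul_lap (s : ℝ) (w : Weights n) :
    (NormedSpace.exp (-s • lap w))ᵀ = NormedSpace.exp (-s • lap w) := by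
  have h := (posSemidef_exp (neg_smul_lap_isHermitian s w)).1.eq
  rwa [conjTranspose_eq_transpose_of_trivial] at h

lemma sum_sq_edgeVec_ne_zero (s : ℝ) (w : Weights n) {i j : Fin n} (hij : i ≠ j) :
    ∑ l, edgeVec s w i j l ^ 2 ≠ 0 := by
  intro h
  have hvec : edgeVec s w i j = 0 := by
    rw [Finset.sum_eq_zero_iff_of_nonneg fun l _ => sq_nonneg _] at h
    exact funext fun l => pow_eq_zero_iff two_ne_zero |>.1 (h l (Finset.mem_univ l))
  have hker : (Pi.single i 1 - Pi.single j 1 : Fin n → ℝ) = 0 :=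
    mulVec_injective_of_isUnit (Matrix.isUnit_exp (-s • lap w)) (hvec.trans (mulVec_zero _).symm)
  simpa [hij] using congrFun hker i

lemma matInner_vecMulVec_mul_transpose {m : ℕ} (v : Fin n → ℝ) (B : Matrix (Fin n) (Fin m) ℝ) :
    matInner (vecMulVec v v) (B * Bᵀ) = ∑ l, (v ᵥ* B) l ^ 2 := by
  simp only [matInner, vecMulVec_apply, Matrix.mul_apply, transpose_apply, vecMul, dotProduct, sq,
    Finset.sum_mul, Finset.mul_sum]
  rw [Finset.sum_congr rfl fun i _ => Finset.sum_comm, Finset.sum_comm]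
  exact Finset.sum_congr rfl fun l _ => Finset.sum_congr rfl fun i _ =>
    Finset.sum_congr rfl fun j _ => by ring

lemma exp_two_mul_smul_lap (s : ℝ) (w : Weights n) :
    NormedSpace.exp (-(2 * s) • lap w) =
      NormedSpace.exp (-s • lap w) * (NormedSpace.exp (-s • lap w))ᵀ := by
  rw [transpose_exp_smul_lap, ← Matrix.exp_add_of_commute _ _ (Commute.refl _), ← add_smul]
  congr 2
  ring

lemma matInner_edgeLap_exp (s : ℝ) (w : Weights n) (i j : Fin n) :
    matInner (edgeLap s(i, j)) (NormedSpace.exp (-(2 * s) • lap w)) =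
      ∑ l, edgeVec s w i j l ^ 2 := by
  rw [exp_two_mul_smul_lap, edgeLap_mk, matInner_vecMulVec_mul_transpose, ← mulVec_transpose,
    transpose_exp_smul_lap, edgeVec]

lemma matInner_edgeLap_sketch (p ε : ℝ) (w : Weights n) (R : Fin n → Fin k → ℝ) (i j : Fin n) :
    matInner (edgeLap s(i, j)) (sketch p ε w R * (sketch p ε w R)ᵀ) =
      ∑ l, (∑ i', R i' l * edgeVec (stepSize n p ε) w i j i') ^ 2 := by
  rw [edgeLap_mk, matInner_vecMulVec_mul_transpose]
  refine Finset.sum_congr rfl fun l _ => ?_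
  rw [sketch, ← vecMul_vecMul, ← mulVec_transpose _ (Pi.single i 1 - Pi.single j 1),
    transpose_exp_smul_lap, ← edgeVec]
  simp only [vecMul, dotProduct, of_apply, mul_comm]

lemma abs_relError_edgeVec_le (s ε : ℝ) (w : Weights n) (R : Fin n → Fin k → ℝ) {i j : Fin n}
    (hij : i ≠ j) : |relError (edgeVec s w i j) R| ≤ ε + excess s ε w R := by
  have hmem : (i, j) ∈ (Finset.univ : Finset (Fin n)).offDiag := by simp [hij]
  have h := Finset.single_le_sum (f := fun x : Fin n × Fin n =>
      max 0 (|relError (edgeVec s w x.1 x.2) R| - ε)) (fun _ _ => le_max_left _ _) hmem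
  exact sub_le_iff_le_add'.1 ((le_max_right _ _).trans h)

lemma abs_matInner_edgeLap_sketch_sub_le (p ε : ℝ) (w : Weights n) (R : Fin n → Fin k → ℝ)
    (e : Sym2 (Fin n)) :
    |matInner (edgeLap e) (sketch p ε w R * (sketch p ε w R)ᵀ) -
      matInner (edgeLap e) (NormedSpace.exp (-(2 * stepSize n p ε) • lap w))| ≤
      (ε + excess (stepSize n p ε) ε w R) *
        matInner (edgeLap e) (NormedSpace.exp (-(2 * stepSize n p ε) • lap w)) := by
  induction e with | _ i j => ?_
  rcases eq_or_ne i j with rfl | hij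
  · simp [matInner]
  have hne := sum_sq_edgeVec_ne_zero (stepSize n p ε) w hij
  have hnonneg : 0 ≤ ∑ l, edgeVec (stepSize n p ε) w i j l ^ 2 := by positivity
  have herr := mul_le_mul_of_nonneg_right
    (abs_relError_edgeVec_le (stepSize n p ε) ε w R hij) hnonneg
  rwa [← abs_of_nonneg hnonneg, ← abs_mul, abs_of_nonneg hnonneg, relError, sub_mul,
    div_mul_cancel₀ _ hne, one_mul, ← matInner_edgeLap_exp, ← matInner_edgeLap_sketch] at herr

lemma abs_matInner_lap_sub_le {S W : Matrix (Fin n) (Fin n) ℝ} {δ : ℝ}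
    (h : ∀ e, |matInner (edgeLap e) S - matInner (edgeLap e) W| ≤ δ * matInner (edgeLap e) W)
    {v : Weights n} (hv : 0 ≤ v) :
    |matInner (lap v) S - matInner (lap v) W| ≤ δ * matInner (lap v) W := by
  simp only [matInner_lap, ← Finset.sum_sub_distrib, ← mul_sub, Finset.mul_sum]
  refine (Finset.abs_sum_le_sum_abs _ _).trans (Finset.sum_le_sum fun e _ => ?_)
  rw [abs_mul, abs_of_nonneg (hv e), mul_left_comm]
  exact mul_le_mul_of_nonneg_left (h e) (hv e)

lemma matInner_projPerpOnes_pos_of_abs_sub_le (hn : n ≠ 0) {S W : Matrix (Fin n) (Fin n) ℝ}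
    {δ : ℝ} (hδ : δ < 1) (hW : 0 < matInner (projPerpOnes n) W)
    (h : ∀ e, |matInner (edgeLap e) S - matInner (edgeLap e) W| ≤ δ * matInner (edgeLap e) W) :
    0 < matInner (projPerpOnes n) S := by
  have hsum := abs_matInner_lap_sub_le h (v := 1) fun _ => zero_le_one
  rw [matInner_lap_one hn, matInner_lap_one hn] at hsum
  have hn' : (0 : ℝ) < n := by positivity
  have hpos : 0 < (1 - δ) * (n * matInner (projPerpOnes n) W) := by
    have := sub_pos.2 hδ
    positivity
  refine pos_of_mul_pos_right (hpos.trans_le ?_) hn'.le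
  linarith [(abs_le.1 hsum).1]

lemma gains_eq (p ε : ℝ) (w : Weights n) (R : Fin n → Fin k → ℝ) (e : Sym2 (Fin n)) :
    gains p ε w R e = (matInner (projPerpOnes n) (sketch p ε w R * (sketch p ε w R)ᵀ))⁻¹ *
      matInner (edgeLap e) (sketch p ε w R * (sketch p ε w R)ᵀ) := by
  have h : 0 ≤ matInner (projPerpOnes n) (sketch p ε w R * (sketch p ε w R)ᵀ) :=
    matInner_nonneg projPerpOnes_posSemidef (posSemidef_self_mul_conjTranspose (sketch p ε w R))
  rw [gains, normSketch, transpose_smul, Matrix.smul_mul, Matrix.mul_smul, smul_smul, ← mul_inv,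
    Real.mul_self_sqrt h, matInner_smul_right]

lemma sum_gains_mul (p ε : ℝ) (w : Weights n) (R : Fin n → Fin k → ℝ) (v : Weights n) :
    ∑ e, gains p ε w R e * v e =
      (matInner (projPerpOnes n) (sketch p ε w R * (sketch p ε w R)ᵀ))⁻¹ *
        matInner (lap v) (sketch p ε w R * (sketch p ε w R)ᵀ) := by
  rw [matInner_lap, Finset.mul_sum]
  exact Finset.sum_congr rfl fun e _ => by rw [gains_eq]; ring

lemma IsApproxSolution.mul_matInner_lap_exp_le (hn : 2 ≤ n) {α p ε : ℝ} (hα : 0 ≤ α) (hε : 0 ≤ ε)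
    {G : SimpleGraph (Fin n)} {w v v' : Weights n} {R : Fin n → Fin k → ℝ}
    (h : IsApproxSolution α p G (gains p ε w R) v) (hv' : v' ∈ feasible G p) :
    α * (1 - (ε + excess (stepSize n p ε) ε w R)) *
        matInner (lap v') (NormedSpace.exp (-(2 * stepSize n p ε) • lap w)) ≤
      (1 + (ε + excess (stepSize n p ε) ε w R)) *
        matInner (lap v) (NormedSpace.exp (-(2 * stepSize n p ε) • lap w)) := by
  have hedge := abs_matInner_edgeLap_sketch_sub_le p ε w R
  have hA := neg_smul_lap_isHermitian (2 * stepSize n p ε) w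
  set W := NormedSpace.exp (-(2 * stepSize n p ε) • lap w)
  set S := sketch p ε w R * (sketch p ε w R)ᵀ
  have hδ₀ : 0 ≤ ε + excess (stepSize n p ε) ε w R := add_nonneg hε (excess_nonneg _ _ _ _)
  set δ := ε + excess (stepSize n p ε) ε w R
  rcases le_or_gt 1 δ with hδ | hδ
  · have hv'W := matInner_nonneg (lap_posSemidef hv'.1) (posSemidef_exp hA)
    have hvW := matInner_nonneg (lap_posSemidef h.1.1) (posSemidef_exp hA)
    have hleft : α * (1 - δ) * matInner (lap v') W ≤ 0 := mul_nonpos_of_nonpos_of_nonneg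
      (mul_nonpos_of_nonneg_of_nonpos hα (sub_nonpos.2 hδ)) hv'W
    exact hleft.trans (by positivity)
  · have hpos := matInner_projPerpOnes_pos_of_abs_sub_le (by omega) hδ
      (matInner_projPerpOnes_exp_pos hn hA) hedge
    have horacle := h.2 v' hv'
    rw [sum_gains_mul, sum_gains_mul, mul_left_comm, mul_le_mul_iff_right₀ (inv_pos.2 hpos)]
      at horacle
    calc α * (1 - δ) * matInner (lap v') W = α * ((1 - δ) * matInner (lap v') W) := mul_assoc ..
      _ ≤ α * matInner (lap v') S := mul_le_mul_of_nonneg_left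
          (by linarith [(abs_le.1 (abs_matInner_lap_sub_le hedge hv'.1)).1]) hα
      _ ≤ matInner (lap v) S := horacle
      _ ≤ (1 + δ) * matInner (lap v) W := by
          linarith [(abs_le.1 (abs_matInner_lap_sub_le hedge h.1.1)).2]

lemma zero_mem_feasible {p : ℝ} (hp : 0 ≤ p) (G : SimpleGraph (Fin n)) :
    (0 : Weights n) ∈ feasible G p :=
  ⟨fun _ => le_rfl, fun _ _ => rfl, fun i => by
    simp only [wdeg, Pi.zero_apply, Finset.sum_const_zero]
    positivity, fun _ _ => zero_le_one⟩

lemma opt_nonneg (G : SimpleGraph (Fin n)) (p : ℝ) : 0 ≤ opt G p := by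
  refine Real.sSup_nonneg ?_
  rintro _ ⟨w, hw, rfl⟩
  exact objective_nonneg hw.1

lemma objective_le_opt (hn : 2 ≤ n) {G : SimpleGraph (Fin n)} {p : ℝ} {w : Weights n}
    (hw : w ∈ feasible G p) : objective w ≤ opt G p := by
  obtain ⟨X, hX⟩ := specSet_nonempty hn
  refine le_csSup ⟨∑ e, matInner (edgeLap e) X, ?_⟩ ⟨w, hw, rfl⟩
  rintro _ ⟨v, hv, rfl⟩
  refine (objective_le hv.1 hX).trans ?_
  rw [matInner_lap]
  refine Finset.sum_le_sum fun e _ => ?_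
  refine mul_le_of_le_one_left (matInner_nonneg (edgeLap_posSemidef e) hX.1) ?_
  by_cases he : e ∈ G.edgeSet
  · exact hv.2.2.2 e he
  · exact (hv.2.1 e he).trans_le zero_le_one

lemma mul_opt_mul_potential_le (hn : 2 ≤ n) {p s β M : ℝ} (hp : 0 ≤ p) (hβ : 0 ≤ β)
    {G : SimpleGraph (Fin n)} {w : Weights n}
    (h : ∀ v ∈ feasible G p, β * matInner (lap v) (NormedSpace.exp (-s • lap w)) ≤ M) :
    β * opt G p * potential s w ≤ M := by
  have hφ := potential_pos hn s w
  have hobjective (v) (hv : v ∈ feasible G p) : β * objective v * potential s w ≤ M := by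
    have hdual := objective_le hv.1
      (inv_smul_exp_mem_specSet hn (neg_smul_lap_isHermitian s w))
    rw [matInner_smul_right, ← potential, ← div_eq_inv_mul, le_div_iff₀ hφ] at hdual
    rw [mul_assoc]
    exact (mul_le_mul_of_nonneg_left hdual hβ).trans (h v hv)
  rcases hβ.eq_or_lt with rfl | hβ
  · simpa using hobjective 0 (zero_mem_feasible hp G)
  · rw [← le_div_iff₀ hφ, ← le_div_iff₀' hβ]
    refine csSup_le ⟨_, 0, zero_mem_feasible hp G, rfl⟩ ?_
    rintro _ ⟨v, hv, rfl⟩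
    rw [le_div_iff₀' hβ, le_div_iff₀ hφ]
    exact hobjective v hv

lemma IsApproxSolution.opt_mul_potential_le (hn : 2 ≤ n) {α p ε : ℝ} (hα : 0 ≤ α) (hp : 0 ≤ p)
    (hε : 0 ≤ ε) {G : SimpleGraph (Fin n)} {w v : Weights n} {R : Fin n → Fin k → ℝ}
    (h : IsApproxSolution α p G (gains p ε w R) v) :
    α * (1 - 2 * (ε + excess (stepSize n p ε) ε w R)) * opt G p *
        potential (2 * stepSize n p ε) w ≤
      matInner (lap v) (NormedSpace.exp (-(2 * stepSize n p ε) • lap w)) := by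
  have hφ := potential_pos hn (2 * stepSize n p ε) w
  have hδ₀ : 0 ≤ ε + excess (stepSize n p ε) ε w R := add_nonneg hε (excess_nonneg _ _ _ _)
  have hvW := matInner_nonneg (lap_posSemidef h.1.1)
    (posSemidef_exp (neg_smul_lap_isHermitian (2 * stepSize n p ε) w))
  have hopt := mul_nonneg hα (opt_nonneg G p)
  have hround := fun v' => h.mul_matInner_lap_exp_le hn hα hε (v' := v')
  set δ := ε + excess (stepSize n p ε) ε w R
  set φ := potential (2 * stepSize n p ε) w
  rcases le_or_gt 1 δ with hδ | hδ
  · refine le_trans ?_ hvW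
    nlinarith [mul_nonneg hopt hφ.le]
  · have hbound := mul_opt_mul_potential_le hn hp (mul_nonneg hα (sub_nonneg.2 hδ.le)) hround
    refine le_of_mul_le_mul_left (hbound.trans' ?_) (by linarith : 0 < 1 + δ)
    nlinarith [mul_nonneg (mul_nonneg hopt hφ.le) (sq_nonneg δ)]

end Sketch

section Regret

variable {n k : ℕ}

lemma accum_eq_sum (what : ℕ → Weights n) (t : ℕ) :
    accum what t = ∑ u ∈ Finset.range t, what u := by
  induction t with
  | zero => rfl
  | succ t ih => rw [accum, ih, Finset.sum_range_succ]

lemma numIter_pos (hn : 2 ≤ n) {ε : ℝ} (hε : 0 < ε) : 0 < numIter n ε := by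
  have hlog : 0 < Real.log n := Real.log_pos (by exact_mod_cast hn)
  exact Nat.ceil_pos.2 (by positivity)

lemma two_mul_stepSize (n : ℕ) (p ε : ℝ) : 2 * stepSize n p ε = ε / (2 * n * p) := by
  unfold stepSize
  field_simp
  ring

lemma stepSize_pos (hn : 0 < n) {p ε : ℝ} (hp : 0 < p) (hε : 0 < ε) : 0 < stepSize n p ε := by
  unfold stepSize
  positivity

lemma IsApproxSolution.potential_add_le (hn : 2 ≤ n) {α p ε : ℝ} (hα : 0 ≤ α) (hp : 0 < p)
    (hε : 0 < ε) (hε1 : ε ≤ 1 / 4) {G : SimpleGraph (Fin n)} {w v : Weights n}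
    {R : Fin n → Fin k → ℝ} (h : IsApproxSolution α p G (gains p ε w R) v) :
    potential (2 * stepSize n p ε) (w + v) ≤ potential (2 * stepSize n p ε) w *
      Real.exp (-((1 - 4 * ε) * (2 * stepSize n p ε) *
        (α * (1 - 2 * (ε + excess (stepSize n p ε) ε w R)) * opt G p))) := by
  have hn₀ : 0 < n := by omega
  have hs : 0 < 2 * stepSize n p ε := mul_pos two_pos (stepSize_pos hn₀ hp hε)
  have hbs : 4 * (2 * n * p) * (2 * stepSize n p ε) = 4 * ε := by
    rw [two_mul_stepSize]
    field_simp
  have hdecrease := MMWU.potential_add_le hn₀.ne' hs (by positivity) w h.1.1 h.1.2.2.1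
  have hgain := h.opt_mul_potential_le hn hα hp.le hε.le
  rw [hbs] at hdecrease
  have hφ := potential_pos hn (2 * stepSize n p ε) w
  set s := 2 * stepSize n p ε
  set γ := α * (1 - 2 * (ε + excess (stepSize n p ε) ε w R)) * opt G p
  calc potential s (w + v)
      ≤ potential s w - (1 - 4 * ε) * s * (γ * potential s w) := by
        have := mul_le_mul_of_nonneg_left hgain
          (mul_nonneg (by linarith : 0 ≤ 1 - 4 * ε) hs.le)
        linarith
    _ = potential s w * (-((1 - 4 * ε) * s * γ) + 1) := by ring
    _ ≤ potential s w * Real.exp (-((1 - 4 * ε) * s * γ)) :=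
        mul_le_mul_of_nonneg_left (Real.add_one_le_exp _) hφ.le

lemma potential_accum_le (hn : 2 ≤ n) {α p ε : ℝ} (hα : 0 ≤ α) (hp : 0 < p) (hε : 0 < ε)
    (hε1 : ε ≤ 1 / 4) {G : SimpleGraph (Fin n)} {what : ℕ → Weights n}
    {R : ℕ → Fin n → Fin k → ℝ} {T : ℕ}
    (h : ∀ t < T, IsApproxSolution α p G (gains p ε (accum what t) (R t)) (what t)) :
    potential (2 * stepSize n p ε) (accum what T) ≤ (n - 1) *
      Real.exp (-((1 - 4 * ε) * (2 * stepSize n p ε) * ∑ t ∈ Finset.range T,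
        α * (1 - 2 * (ε + excess (stepSize n p ε) ε (accum what t) (R t))) * opt G p)) := by
  induction T with
  | zero => simp [accum, potential_zero_weights (by omega : n ≠ 0)]
  | succ T ih =>
    have hround := (h T T.lt_succ_self).potential_add_le hn hα hp hε hε1
    refine (hround.trans (mul_le_mul_of_nonneg_right
      (ih fun t ht => h t (ht.trans T.lt_succ_self)) (Real.exp_pos _).le)).trans_eq ?_
    rw [mul_assoc, ← Real.exp_add, Finset.sum_range_succ, mul_add (_ * _), neg_add]

lemma output_mem_feasible {p ε : ℝ} (hT : 0 < numIter n ε) {G : SimpleGraph (Fin n)}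
    {what : ℕ → Weights n} (h : ∀ t < numIter n ε, what t ∈ feasible G p) :
    output ε what ∈ feasible G p := by
  have hT' : (0 : ℝ) < numIter n ε := Nat.cast_pos.2 hT
  have hmem : ∀ t ∈ Finset.range (numIter n ε), what t ∈ feasible G p :=
    fun t ht => h t (Finset.mem_range.1 ht)
  have happ (e) : output ε what e =
      (∑ t ∈ Finset.range (numIter n ε), what t e) / numIter n ε := by
    simp [output, Finset.sum_apply, div_eq_inv_mul]
  refine ⟨fun e => ?_, fun e he => ?_, fun i => ?_, fun e he => ?_⟩
  · rw [happ]
    exact div_nonneg (Finset.sum_nonneg fun t ht => (hmem t ht).1 e) hT'.le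
  · rw [happ, Finset.sum_eq_zero fun t ht => (hmem t ht).2.1 e he, zero_div]
  · have hwdeg : wdeg (output ε what) i =
        (∑ t ∈ Finset.range (numIter n ε), wdeg (what t) i) / numIter n ε := by
      simp only [wdeg, happ, ← Finset.sum_div]
      rw [Finset.sum_comm]
    rw [hwdeg, div_le_iff₀ hT']
    refine (Finset.sum_le_sum fun t ht => (hmem t ht).2.2.1 i).trans_eq ?_
    rw [Finset.sum_const, Finset.card_range, nsmul_eq_mul, mul_comm]
  · rw [happ, div_le_iff₀ hT', one_mul]
    refine (Finset.sum_le_sum fun t ht => (hmem t ht).2.2.2 e he).trans_eq ?_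
    simp

lemma potential_accum_numIter {ε : ℝ} (hT : 0 < numIter n ε) (s : ℝ) (what : ℕ → Weights n) :
    potential s (accum what (numIter n ε)) = potential (s * numIter n ε) (output ε what) := by
  have hT' : (numIter n ε : ℝ) ≠ 0 := by positivity
  rw [output, ← accum_eq_sum, potential, potential, lap_smul, smul_smul]
  congr 3
  field_simp

lemma sum_sub_log_le_objective_output (hn : 2 ≤ n) {α p ε : ℝ} (hα : 0 ≤ α) (hp : 0 < p)
    (hε : 0 < ε) (hε1 : ε ≤ 1 / 4) {G : SimpleGraph (Fin n)} {what : ℕ → Weights n}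
    {R : ℕ → Fin n → Fin k → ℝ}
    (h : ∀ t < numIter n ε, IsApproxSolution α p G (gains p ε (accum what t) (R t)) (what t)) :
    (1 - 4 * ε) * (2 * stepSize n p ε) * (∑ t ∈ Finset.range (numIter n ε),
      α * (1 - 2 * (ε + excess (stepSize n p ε) ε (accum what t) (R t))) * opt G p) -
        Real.log n ≤
      2 * stepSize n p ε * numIter n ε * objective (output ε what) := by
  have hT := numIter_pos hn hε
  have hn₀ : 0 < n := by omega
  have hs := stepSize_pos hn₀ hp hε
  have hpot := potential_accum_le hn hα hp hε hε1 h
  have hsT : 0 < 2 * stepSize n p ε * numIter n ε := by positivity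
  rw [potential_accum_numIter hT] at hpot
  have hlog := Real.log_le_log (potential_pos hn _ _)
    (hpot.trans (mul_le_mul_of_nonneg_right (sub_le_self _ zero_le_one) (Real.exp_pos _).le))
  rw [Real.log_mul (Nat.cast_ne_zero.2 hn₀.ne') (Real.exp_pos _).ne', Real.log_exp] at hlog
  linarith [neg_log_potential_le hn hsT (output ε what)]

lemma IsWellConnected.indWeights_mem_feasible {p : ℝ} {H G : SimpleGraph (Fin n)}
    (hH : IsWellConnected p H) (hHG : H ≤ G) : indWeights H.edgeSet ∈ feasible G p :=
  ⟨indWeights_nonneg _, fun _ he => Set.indicator_of_notMem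
    (fun h => he (SimpleGraph.edgeSet_mono hHG h)) _, hH.1,
    fun e _ => Set.indicator_le_self' (f := 1) (fun _ _ => zero_le_one) e⟩

lemma IsWellConnected.le_opt (hn : 2 ≤ n) {p : ℝ} {H G : SimpleGraph (Fin n)}
    (hH : IsWellConnected p H) (hHG : H ≤ G) : n * p / 4 ≤ opt G p :=
  hH.2.trans (objective_le_opt hn (hH.indWeights_mem_feasible hHG))

lemma log_le_mul_opt (hn : 2 ≤ n) {p ε : ℝ} (hp : 0 < p) (hε : 0 < ε) {G : SimpleGraph (Fin n)}
    (hopt : n * p / 4 ≤ opt G p) :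
    Real.log n ≤ 2 * stepSize n p ε * numIter n ε * (ε * opt G p) := by
  have : (0 : ℝ) < n := by positivity
  have hT : 8 * Real.log n / ε ^ 2 ≤ numIter n ε := Nat.le_ceil _
  calc Real.log n = ε / (2 * n * p) * (8 * Real.log n / ε ^ 2) * (ε * (n * p / 4)) := by
        field_simp
        ring
    _ ≤ ε / (2 * n * p) * numIter n ε * (ε * opt G p) := by gcongr
    _ = _ := by rw [two_mul_stepSize]

lemma le_sum_of_sum_excess_le {α ε o : ℝ} (hα : 0 ≤ α) (ho : 0 ≤ o) {x : ℕ → ℝ} {T : ℕ}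
    (hx : ∑ t ∈ Finset.range T, x t ≤ ε * T) :
    α * (T * (1 - 4 * ε)) * o ≤ ∑ t ∈ Finset.range T, α * (1 - 2 * (ε + x t)) * o := by
  rw [← Finset.sum_mul, ← Finset.mul_sum]
  refine mul_le_mul_of_nonneg_right (mul_le_mul_of_nonneg_left ?_ hα) ho
  simp only [Finset.sum_sub_distrib, ← Finset.mul_sum, Finset.sum_add_distrib, Finset.sum_const,
    Finset.card_range, nsmul_eq_mul, mul_one]
  linarith

lemma mul_opt_le_objective_output (hn : 2 ≤ n) {α p ε : ℝ} (hα : 0 ≤ α) (hα1 : α ≤ 1)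
    (hp : 0 < p) (hε : 0 < ε) {G : SimpleGraph (Fin n)} (hopt : n * p / 4 ≤ opt G p)
    {what : ℕ → Weights n} {R : ℕ → Fin n → Fin k → ℝ}
    (h : ∀ t < numIter n ε, IsApproxSolution α p G (gains p ε (accum what t) (R t)) (what t))
    (hexc : ∑ t ∈ Finset.range (numIter n ε), excess (stepSize n p ε) ε (accum what t) (R t) ≤
      ε * numIter n ε) :
    (α - 9 * ε) * opt G p ≤ objective (output ε what) := by
  have hopt₀ := opt_nonneg G p
  have hT := numIter_pos hn hε
  rcases le_or_gt ε (1 / 4) with hε1 | hε1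
  · have hs := stepSize_pos (by omega : 0 < n) hp hε
    have hregret := sum_sub_log_le_objective_output hn hα hp hε hε1 h
    have hlog := log_le_mul_opt hn hp hε hopt
    have hsum := mul_le_mul_of_nonneg_left (le_sum_of_sum_excess_le hα hopt₀ hexc)
      (mul_nonneg (by linarith : 0 ≤ 1 - 4 * ε) (mul_pos two_pos hs).le)
    have hfactor : (α - 9 * ε) * opt G p ≤
        (1 - 4 * ε) * (α * (1 - 4 * ε)) * opt G p - ε * opt G p := by
      rw [← sub_mul]
      refine mul_le_mul_of_nonneg_right ?_ hopt₀
      nlinarith [mul_nonneg hα (sq_nonneg ε), mul_nonneg hε.le (sub_nonneg.2 hα1)]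
    have hsT : 0 < 2 * stepSize n p ε * numIter n ε := by positivity
    refine le_of_mul_le_mul_left ((mul_le_mul_of_nonneg_left hfactor hsT.le).trans ?_) hsT
    linarith
  · have hmem := output_mem_feasible hT fun t ht => (h t ht).1
    exact (mul_nonpos_of_nonpos_of_nonneg (by linarith) hopt₀).trans (objective_nonneg hmem.1)

end Regret

section Randomness

open scoped BigOperators

variable {n k : ℕ}

lemma continuous_exp_lap (s : ℝ) :
    Continuous fun w : Weights n => NormedSpace.exp (-s • lap w) := by
  have hlap : Continuous fun w : Weights n => -s • lap w := by
    unfold lap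
    fun_prop
  let : NormedRing (Matrix (Fin n) (Fin n) ℝ) := Matrix.linftyOpNormedRing
  let : NormedAlgebra ℝ (Matrix (Fin n) (Fin n) ℝ) := Matrix.linftyOpNormedAlgebra
  let : NormedAlgebra ℚ (Matrix (Fin n) (Fin n) ℝ) := .restrictScalars ℚ ℝ _
  exact NormedSpace.exp_continuous.comp hlap

lemma continuous_edgeVec (s : ℝ) (i j : Fin n) :
    Continuous fun w : Weights n => edgeVec s w i j :=
  (continuous_exp_lap s).matrix_mulVec continuous_const

lemma measurable_excess (s ε : ℝ) :
    Measurable fun x : Weights n × (Fin n → Fin k → ℝ) => excess s ε x.1 x.2 := by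
  have hvec (i j l : Fin n) : Measurable fun x : Weights n × (Fin n → Fin k → ℝ) =>
      edgeVec s x.1 i j l :=
    (((continuous_apply l).comp (continuous_edgeVec s i j)).comp continuous_fst).measurable
  unfold excess relError
  fun_prop

lemma two_mul_mul_exp_neg_le_inv_pow (hn : 2 ≤ n) {m : ℕ} {x : ℝ} (hx : (m + 2) * Real.log n ≤ x) :
    2 * n * Real.exp (-x) ≤ ((n : ℝ) ^ m)⁻¹ := by
  have : (0 : ℝ) < n := by positivity
  have hn₂ : (2 : ℝ) ≤ n := by exact_mod_cast hn
  calc 2 * n * Real.exp (-x) ≤ n * n * Real.exp (-((m + 2 : ℕ) * Real.log n)) := by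
        push_cast
        gcongr
    _ = ((n : ℝ) ^ m)⁻¹ := by
        rw [← Real.log_pow, Real.exp_neg, Real.exp_log (by positivity)]
        field_simp
        ring

lemma measure_not_isWellConnected_le (hn : 2 ≤ n) (p : unitInterval)
    (hp : 416 * Real.log n / n ≤ (p : ℝ)) :
    SimpleGraph.binomialRandom (Fin n) p {G | ¬ IsWellConnected p G} ≤
      ENNReal.ofReal ((n : ℝ) ^ 11)⁻¹ := by
  have hn₀ : (0 : ℝ) < n := by positivity
  rw [div_le_iff₀ hn₀] at hp
  rw [← ofReal_measureReal]
  exact ENNReal.ofReal_le_ofReal ((binomialRandom_real_not_isWellConnected_le hn p).trans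
    (two_mul_mul_exp_neg_le_inv_pow hn (by push_cast; linarith)))

lemma sketch_error_le (hn : 2 ≤ n) {ε : ℝ} (hε : 0 < ε) (hk : 13312 * Real.log n / ε ^ 2 ≤ k) :
    1024 / (ε * k) * Real.exp (-(ε ^ 2 * k / 1024)) ≤ ε * ((n : ℝ) ^ 13)⁻¹ := by
  have hlog : 1 / 2 < Real.log n := by
    have : Real.log 2 ≤ Real.log n := Real.log_le_log two_pos (by exact_mod_cast hn)
    linarith [Real.log_two_gt_d9]
  have hk₀ : (0 : ℝ) < k := lt_of_lt_of_le (by positivity) hk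
  rw [div_le_iff₀ (by positivity)] at hk
  refine mul_le_mul ?_ ?_ (Real.exp_pos _).le hε.le
  · rw [div_le_iff₀ (by positivity)]
    linarith
  · rw [← Real.exp_log (show (0 : ℝ) < n ^ 13 by positivity), ← Real.exp_neg, Real.exp_le_exp,
      Real.log_pow]
    push_cast
    linarith

lemma lintegral_excess_le (hn : 2 ≤ n) (s : ℝ) {ε : ℝ} (hε : 0 < ε) (hε1 : ε ≤ 1)
    (hk : 13312 * Real.log n / ε ^ 2 ≤ k) (w : Weights n) :
    ∫⁻ R, ENNReal.ofReal (excess s ε w R) ∂uniformOn (signMatrices n k) ≤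
      ENNReal.ofReal (ε * ((n : ℝ) ^ 11)⁻¹) := by
  have hlog : 0 < Real.log n := Real.log_pos (by exact_mod_cast hn)
  have hk₀ : k ≠ 0 := by
    rintro rfl
    exact absurd hk (not_le.2 (by rw [Nat.cast_zero]; positivity))
  rw [← range_signMatrix, lintegral_uniformOn_range signMatrix_injective (excess_nonneg s ε w)]
  refine ENNReal.ofReal_le_ofReal ?_
  unfold excess
  rw [Finset.expect_sum_comm]
  calc ∑ x ∈ (Finset.univ : Finset (Fin n)).offDiag, 𝔼 σ : Fin k → Fin n → ℤˣ,
        max 0 (|relError (edgeVec s w x.1 x.2) (signMatrix σ)| - ε)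
      ≤ ∑ _x ∈ (Finset.univ : Finset (Fin n)).offDiag, ε * ((n : ℝ) ^ 13)⁻¹ :=
        Finset.sum_le_sum fun x hx => (expect_relError_excess_le hk₀ (sum_sq_edgeVec_ne_zero s w
          (Finset.mem_offDiag.1 hx).2.2) hε hε1).trans (sketch_error_le hn hε hk)
    _ ≤ n ^ 2 * (ε * ((n : ℝ) ^ 13)⁻¹) := by
        rw [Finset.sum_const, nsmul_eq_mul, Finset.offDiag_card, Finset.card_univ,
          Fintype.card_fin, sq]
        gcongr
        exact_mod_cast Nat.sub_le _ _
    _ = ε * ((n : ℝ) ^ 11)⁻¹ := by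
        field_simp

variable {Ω : Type*} [mΩ : MeasurableSpace Ω] {P : Measure Ω} {G : Ω → SimpleGraph (Fin n)}
  {p ε : ℝ} {solves : SimpleGraph (Fin n) → Weights n → Weights n → Prop} {ℱ : Filtration ℕ mΩ}
  {R : ℕ → Ω → Fin n → Fin k → ℝ} {what : ℕ → Ω → Weights n}

lemma IsRun.measurable_accum (hrun : IsRun P G p ε solves ℱ R what) {t : ℕ}
    (ht : t ≤ numIter n ε) : Measurable[ℱ t] fun ω => accum (fun s => what s ω) t := by
  induction t with
  | zero => exact measurable_const
  | succ t ih =>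
    exact ((ih (by omega)).mono (ℱ.mono (Nat.le_succ t)) le_rfl).add
      (hrun.answer_measurable t (by omega))

lemma IsRun.measurable_accum_prodMk_sample (hrun : IsRun P G p ε solves ℱ R what) {t : ℕ}
    (ht : t < numIter n ε) : Measurable fun ω => (accum (fun s => what s ω) t, R t ω) :=
  ((hrun.measurable_accum ht.le).mono (ℱ.le _) le_rfl).prodMk
    ((hrun.sample_measurable t ht).mono (ℱ.le _) le_rfl)

lemma IsRun.map_accum_prodMk_sample [IsProbabilityMeasure P]
    (hrun : IsRun P G p ε solves ℱ R what) {t : ℕ} (ht : t < numIter n ε) :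
    P.map (fun ω => (accum (fun s => what s ω) t, R t ω)) =
      (P.map fun ω => accum (fun s => what s ω) t).prod (uniformOn (signMatrices n k)) := by
  have haccum := hrun.measurable_accum ht.le
  have hindep : IndepFun (fun ω => accum (fun s => what s ω) t) (R t) P := by
    rw [IndepFun_iff_Indep]
    exact indep_of_indep_of_le_left (hrun.sample_indep t ht).symm haccum.comap_le
  rw [(indepFun_iff_map_prod_eq_prod_map_map (haccum.mono (ℱ.le t) le_rfl).aemeasurable
    (hrun.sample_law t ht).aemeasurable).1 hindep, (hrun.sample_law t ht).map_eq]

lemma IsRun.lintegral_excess_le [IsProbabilityMeasure P] (hrun : IsRun P G p ε solves ℱ R what)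
    (hn : 2 ≤ n) (hε : 0 < ε) (hε1 : ε ≤ 1) (hk : 13312 * Real.log n / ε ^ 2 ≤ k) (s : ℝ)
    {t : ℕ} (ht : t < numIter n ε) :
    ∫⁻ ω, ENNReal.ofReal (excess s ε (accum (fun u => what u ω) t) (R t ω)) ∂P ≤
      ENNReal.ofReal (ε * ((n : ℝ) ^ 11)⁻¹) := by
  have hmeas : Measurable fun x : Weights n × (Fin n → Fin k → ℝ) =>
      ENNReal.ofReal (excess s ε x.1 x.2) := (measurable_excess s ε).ennreal_ofReal
  have haccum : Measurable fun ω => accum (fun u => what u ω) t :=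
    (hrun.measurable_accum ht.le).mono (ℱ.le t) le_rfl
  have := Measure.isProbabilityMeasure_map (μ := P) haccum.aemeasurable
  rw [← lintegral_map hmeas (hrun.measurable_accum_prodMk_sample ht),
    hrun.map_accum_prodMk_sample ht, lintegral_prod _ hmeas.aemeasurable]
  exact (lintegral_mono fun w => MMWU.lintegral_excess_le hn s hε hε1 hk w).trans_eq (by simp)

lemma IsRun.measure_lt_sum_excess_le [IsProbabilityMeasure P]
    (hrun : IsRun P G p ε solves ℱ R what) (hn : 2 ≤ n) (hε : 0 < ε) (hε1 : ε ≤ 1)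
    (hk : 13312 * Real.log n / ε ^ 2 ≤ k) (s : ℝ) :
    P {ω | ε * numIter n ε < ∑ t ∈ Finset.range (numIter n ε),
      excess s ε (accum (fun u => what u ω) t) (R t ω)} ≤ ENNReal.ofReal ((n : ℝ) ^ 11)⁻¹ := by
  have hT : (0 : ℝ) < numIter n ε := Nat.cast_pos.2 (numIter_pos hn hε)
  have hεT : 0 < ε * numIter n ε := mul_pos hε hT
  have hmeas (t) (ht : t ∈ Finset.range (numIter n ε)) : Measurable fun ω =>
      ENNReal.ofReal (excess s ε (accum (fun u => what u ω) t) (R t ω)) :=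
    ((measurable_excess s ε).comp
      (hrun.measurable_accum_prodMk_sample (Finset.mem_range.1 ht))).ennreal_ofReal
  calc P {ω | ε * numIter n ε < ∑ t ∈ Finset.range (numIter n ε),
        excess s ε (accum (fun u => what u ω) t) (R t ω)}
      ≤ P {ω | ENNReal.ofReal (ε * numIter n ε) ≤ ∑ t ∈ Finset.range (numIter n ε),
        ENNReal.ofReal (excess s ε (accum (fun u => what u ω) t) (R t ω))} := by
        refine measure_mono fun ω hω => ?_
        rw [Set.mem_ofPred_eq, ← ENNReal.ofReal_sum_of_nonneg fun t _ => excess_nonneg _ _ _ _]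
        exact ENNReal.ofReal_le_ofReal (le_of_lt hω)
    _ ≤ (∫⁻ ω, ∑ t ∈ Finset.range (numIter n ε),
        ENNReal.ofReal (excess s ε (accum (fun u => what u ω) t) (R t ω)) ∂P) /
          ENNReal.ofReal (ε * numIter n ε) :=
        meas_ge_le_lintegral_div (Finset.measurable_sum _ hmeas).aemeasurable
          (by simpa using hεT) ENNReal.ofReal_ne_top
    _ ≤ (∑ _t ∈ Finset.range (numIter n ε), ENNReal.ofReal (ε * ((n : ℝ) ^ 11)⁻¹)) /
          ENNReal.ofReal (ε * numIter n ε) := by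
        rw [lintegral_finsetSum _ hmeas]
        exact ENNReal.div_le_div_right (Finset.sum_le_sum fun t ht =>
          hrun.lintegral_excess_le hn hε hε1 hk s (Finset.mem_range.1 ht)) _
    _ = ENNReal.ofReal ((n : ℝ) ^ 11)⁻¹ := by
        rw [← ENNReal.ofReal_sum_of_nonneg fun _ _ => by positivity,
          ← ENNReal.ofReal_div_of_pos hεT, Finset.sum_const, Finset.card_range, nsmul_eq_mul]
        congr 1
        field_simp

lemma IsRun.measure_failure_le [IsProbabilityMeasure P] {p : unitInterval}
    (hrun : IsRun P G p ε solves ℱ R what) {α β : ℝ} (hα : 0 ≤ α) (hα1 : α ≤ 1)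
    (hsolves : ∀ H c w, (∀ e, 0 ≤ c e) → solves H c w → IsApproxSolution α p H c w)
    (hβ : β ≤ α - 9 * ε) (hn : 2 ≤ n) (hp : 416 * Real.log n / n ≤ (p : ℝ)) (hε : 0 < ε)
    (hε1 : ε ≤ 1) (hk : 13312 * Real.log n / ε ^ 2 ≤ k) {G₀ : Ω → SimpleGraph (Fin n)}
    (hlaw : HasLaw G₀ (SimpleGraph.binomialRandom (Fin n) p) P) (hle : ∀ ω, G₀ ω ≤ G ω) :
    P {ω | ¬ (output ε (fun t => what t ω) ∈ feasible (G ω) p ∧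
      β * opt (G ω) p ≤ objective (output ε (fun t => what t ω)))} ≤
      ENNReal.ofReal (((n : ℝ) ^ 10)⁻¹) := by
  have hlog : 0 < Real.log n := Real.log_pos (by exact_mod_cast hn)
  have hp₀ : (0 : ℝ) < p := lt_of_lt_of_le (by positivity) hp
  have hsub : {ω | ¬ (output ε (fun t => what t ω) ∈ feasible (G ω) p ∧
      β * opt (G ω) p ≤ objective (output ε (fun t => what t ω)))} ⊆
      (G₀ ⁻¹' {H | ¬ IsWellConnected p H}) ∪
      {ω | ε * numIter n ε < ∑ t ∈ Finset.range (numIter n ε),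
        excess (stepSize n p ε) ε (accum (fun u => what u ω) t) (R t ω)} := by
    intro ω hfail
    by_contra hgood
    rw [Set.mem_union, not_or, Set.mem_preimage, Set.mem_ofPred_eq, not_not, Set.mem_ofPred_eq,
      not_lt] at hgood
    have happrox := fun t ht => hsolves _ _ _ (gains_nonneg _ _ _ _) (hrun.answer_solves t ht ω)
    refine hfail ⟨output_mem_feasible (numIter_pos hn hε) fun t ht => (happrox t ht).1, ?_⟩
    exact (mul_le_mul_of_nonneg_right hβ (opt_nonneg _ _)).trans (mul_opt_le_objective_output hn
      hα hα1 hp₀ hε (hgood.1.le_opt hn (hle ω)) happrox hgood.2)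
  have hgraph : P (G₀ ⁻¹' {H | ¬ IsWellConnected p H}) ≤ ENNReal.ofReal ((n : ℝ) ^ 11)⁻¹ := by
    refine (Measure.le_map_apply hlaw.aemeasurable _).trans ?_
    rw [hlaw.map_eq]
    exact measure_not_isWellConnected_le hn p hp
  refine (measure_mono hsub).trans ((measure_union_le _ _).trans ((add_le_add hgraph
    (hrun.measure_lt_sum_excess_le hn hε hε1 hk _)).trans ?_))
  rw [← ENNReal.ofReal_add (by positivity) (by positivity)]
  refine ENNReal.ofReal_le_ofReal ?_
  have hn₂ : (2 : ℝ) ≤ n := by exact_mod_cast hn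
  calc ((n : ℝ) ^ 11)⁻¹ + ((n : ℝ) ^ 11)⁻¹ = 2 * ((n : ℝ) ^ 11)⁻¹ := by ring
    _ ≤ n * ((n : ℝ) ^ 11)⁻¹ := by gcongr
    _ = ((n : ℝ) ^ 10)⁻¹ := by field_simp

end Randomness

end MMWU

theorem mainTheorem5 :
    ∃ C₀ > (0 : ℝ), ∃ C₁ > (0 : ℝ), ∃ C₂ > (0 : ℝ),
      ∀ (n : ℕ) (p : unitInterval) (ε : ℝ) (k : ℕ),
        2 ≤ n → C₁ * Real.log n / n ≤ (p : ℝ) → 0 < ε → ε ≤ 1 / 2 →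
        C₂ * Real.log n / ε ^ 2 ≤ (k : ℝ) →
        ∀ (Ω : Type*) [mΩ : MeasurableSpace Ω] (P : Measure Ω) [IsProbabilityMeasure P]
          (GER GSR : Ω → SimpleGraph (Fin n)),
          HasLaw GER (SimpleGraph.binomialRandom (Fin n) p) P →
          (∀ ω, GER ω ≤ GSR ω) →
          ∀ (ℱ : Filtration ℕ mΩ) (R : ℕ → Ω → Fin n → Fin k → ℝ)
            (what : ℕ → Ω → MMWU.Weights n),
            -- the oracle is a `(1 - ε)`-approximate LP solver
            (MMWU.IsRun P GSR p ε (MMWU.IsApproxSolution (1 - ε) p) ℱ R what →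
              P {ω | ¬ (MMWU.output ε (fun t => what t ω) ∈ MMWU.feasible (GSR ω) p ∧
                  (1 - C₀ * ε) * MMWU.opt (GSR ω) p ≤
                    MMWU.objective (MMWU.output ε (fun t => what t ω)))} ≤
                ENNReal.ofReal (((n : ℝ) ^ 10)⁻¹)) ∧
            -- the oracle is any `1/2`-approximate solver
            (MMWU.IsRun P GSR p ε (MMWU.IsApproxSolution (1 / 2) p) ℱ R what →
              P {ω | ¬ (MMWU.output ε (fun t => what t ω) ∈ MMWU.feasible (GSR ω) p ∧
                  (1 / 2 - C₀ * ε) * MMWU.opt (GSR ω) p ≤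
                    MMWU.objective (MMWU.output ε (fun t => what t ω)))} ≤
                ENNReal.ofReal (((n : ℝ) ^ 10)⁻¹)) ∧
            -- the oracle is the greedy procedure
            (MMWU.IsRun P GSR p ε (MMWU.IsGreedySolution p) ℱ R what →
              P {ω | ¬ (MMWU.output ε (fun t => what t ω) ∈ MMWU.feasible (GSR ω) p ∧
                  (1 / 2 - C₀ * ε) * MMWU.opt (GSR ω) p ≤
                    MMWU.objective (MMWU.output ε (fun t => what t ω)))} ≤
                ENNReal.ofReal (((n : ℝ) ^ 10)⁻¹)) := by
  refine ⟨10, by norm_num, 416, by norm_num, 13312, by norm_num, ?_⟩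
  intro n p ε k hn hp hε hε1 hk Ω mΩ P _ GER GSR hlaw hle ℱ R what
  have hε1' : ε ≤ 1 := by linarith
  refine ⟨fun hrun => ?_, fun hrun => ?_, fun hrun => ?_⟩
  · exact hrun.measure_failure_le (α := 1 - ε) (by linarith) (by linarith) (fun _ _ _ _ h => h)
      (by linarith) hn hp hε hε1' hk hlaw hle
  · exact hrun.measure_failure_le (α := 1 / 2) (by norm_num) (by norm_num) (fun _ _ _ _ h => h)
      (by linarith) hn hp hε hε1' hk hlaw hle
  · have hlog : 0 < Real.log n := Real.log_pos (by exact_mod_cast hn)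
    have hp₀ : (0 : ℝ) < p := lt_of_lt_of_le (by positivity) hp
    exact hrun.measure_failure_le (α := 1 / 2) (by norm_num) (by norm_num)
      (fun _ _ _ hc h => h.isApproxSolution (by positivity) hc) (by linarith) hn hp hε hε1' hk
      hlaw hle
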